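/- **Setting.** Let $P$ be a simple polygon in the Euclidean plane with edge set $E$, and let $\delta\colon E\to\mathbb{R}_{\ge 0}$ be additive weights. For $e\in E$ let $\overline e$ be the supporting line of $e$ and $n_e$ its inward facing unit normal, and for $t\ge 0$ put $\overline e(t)=\overline e+\max(0,t-\delta(e))\cdot n_e$. The *additively-weighted wavefront* $\mathcal W_{P,\delta}(t)$ is a finite set of simple polygons ("wavefront polygons"), each edge of which emanates from (is labelled by) an edge of $P$, that evolves with time as follows. 1. At time $0$ it consists of $P$ only, every edge emanating from itself. 2. There are finitely many event times. Between successive events each wavefront polygon keeps its cyclic sequence of labelled edges and stays a simple polygon; an edge emanating from $e$ lies on $\overline e(t)$ at time $t$ and $n_e$ points into the wavefront polygon there, so that each wavefront vertex lies on the translated supporting lines of both incident edges. A vertex whose two incident edges are parallel moves only perpendicularly to them. 3. At an event each wavefront polygon, which may have degenerated, is replaced by finitely many (possibly zero) wavefront polygons. Up to finitely many points, their edges cover exactly the edges of the degenerated polygon minus the portions common to two edges that have moved into each other from opposite sides (so edges of length zero disappear, and the polygon is split where its boundary touches itself). Edges keep their labels, except that when edges with the same inward normal form a common straight edge and at least one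 of them starts to move at that time or earlier, one of them may take over the other. 4. The process ends when no wavefront polygon is left; the wavefront is empty from then on. We identify $\mathcal W_{P,\delta}(t)$ with the closed subset of the plane covered by its polygons (boundary and interior). **Lemma (nested wavefronts).** For every simple polygon $P$, all weights $\delta\ge 0$, every such propagation process, and all $0\le t_1<t_2$, $$\mathcal W_{P,\delta}(t_2)\subseteq\mathcal W_{P,\delta}(t_1).$$ The inclusion need not be proper: there are $P$, $\delta\ge 0$, a propagation process, and $0\le t_1<t_2$ with $\mathcal W_{P,\delta}(t_2)=\mathcal W_{P,\delta}(t_1)\neq\emptyset$. -/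

import Mathlib

open Set Filter Topology

noncomputable section

namespace StraightSkeleton

/-- The Euclidean plane. -/
abbrev Plane : Type := EuclideanSpace ℝ (Fin 2)

/-! ### Simple polygons -/

section Polygon

variable {n : ℕ}

/-- The `i`-th edge of the closed polygonal chain with (cyclically indexed) vertices `v`. -/
def edge (v : ZMod n → Plane) (i : ZMod n) : Set Plane :=
  segment ℝ (v i) (v (i + 1))

/-- The closed polygonal curve with vertices `v`. -/
def curve (v : ZMod n → Plane) : Set Plane := ⋃ i, edge v i

/-- The closed region bounded by the curve: the curve together with all bounded connected
components of its complement. -/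
def region (v : ZMod n → Plane) : Set Plane :=
  curve v ∪ {x | x ∉ curve v ∧ Bornology.IsBounded (connectedComponentIn (curve v)ᶜ x)}

/-- The vertices `v` (in cyclic order, clockwise or counterclockwise) form a simple polygon:
there are at least three, edges have positive length, consecutive edges share only their common
vertex, and non-consecutive edges are disjoint. -/
structure IsSimplePolygon (v : ZMod n → Plane) : Prop where
  three_le : 3 ≤ n
  edge_ne : ∀ i, v i ≠ v (i + 1)
  consecutive : ∀ i, edge v i ∩ edge v (i + 1) = {v (i + 1)}
  nonconsecutive : ∀ i j, j ≠ i → j ≠ i + 1 → i ≠ j + 1 → Disjoint (edge v i) (edge v j)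

/-- At the `i`-th edge of the polygon `v`, the vector `ν` points into the bounded region. -/
def PointsInward (v : ZMod n → Plane) (i : ZMod n) (ν : Plane) : Prop :=
  ∀ x ∈ openSegment ℝ (v i) (v (i + 1)), ∀ᶠ ε in 𝓝[>] (0 : ℝ), x + ε • ν ∈ region v

/-- The unit normal of the directed segment from `a` to `b` pointing to its left. -/
def leftNormal (a b : Plane) : Plane := ‖b - a‖⁻¹ • !₂[-(b - a) 1, (b - a) 0]

open Classical in
/-- The inward facing unit normal `n_e` of the edge `e` of the polygon `p`. -/
def inwardNormal (p : ZMod n → Plane) (e : ZMod n) : Plane :=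
  if PointsInward p e (leftNormal (p e) (p (e + 1))) then leftNormal (p e) (p (e + 1))
  else -leftNormal (p e) (p (e + 1))

/-- How far the edge `e` has moved at time `t`: it starts at time `δ e` and has unit speed. -/
def offset (δ : ZMod n → ℝ) (e : ZMod n) (t : ℝ) : ℝ := max 0 (t - δ e)

/-- The supporting line of the edge `e` of `p`, translated by `max (0, t - δ e)` in the direction
of the inward normal of `e`. -/
def offsetLine (p : ZMod n → Plane) (δ : ZMod n → ℝ) (e : ZMod n) (t : ℝ) : Set Plane :=
  (fun y => y + offset δ e t • inwardNormal p e) '' (line[ℝ, p e, p (e + 1)] : Set Plane)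

end Polygon

/-! ### Wavefront polygons -/

/-- A moving polygon: at time `t` its vertices, in cyclic order, are `vertex t j`, and its `j`-th
edge, from `vertex t j` to `vertex t (j + 1)`, emanates from the input edge `label j ∈ E`. -/
structure MovingPolygon (E : Type) where
  size : ℕ
  label : ZMod size → E
  vertex : ℝ → ZMod size → Plane

variable {n : ℕ}

namespace MovingPolygon

/-- At time `t` the moving polygon is a simple polygon, and at each of its edges the inward normal
of the input edge from which that edge emanates points into the polygon. -/
def IsWavefrontPolygonAt (K : MovingPolygon (ZMod n)) (p : ZMod n → Plane) (t : ℝ) : Prop :=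
  IsSimplePolygon (K.vertex t) ∧
    ∀ j, PointsInward (K.vertex t) j (inwardNormal p (K.label j))

/-- The motion of a wavefront polygon between two successive events at times `a ≤ b`. -/
structure MovesBetween (K : MovingPolygon (ZMod n)) (p : ZMod n → Plane) (δ : ZMod n → ℝ)
    (a b : ℝ) : Prop where
  /-- Before the event at time `b` the polygon is a proper wavefront polygon. -/
  planar : ∀ t, (t = a ∨ a ≤ t ∧ t < b) → K.IsWavefrontPolygonAt p t
  /-- Each edge moves inwards in a self-parallel manner on the translated supporting line of its
  input edge, and incidences are preserved. -/
  incident : ∀ t ∈ Icc a b, ∀ j, K.vertex t j ∈ offsetLine p δ (K.label j) t ∧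
    K.vertex t (j + 1) ∈ offsetLine p δ (K.label j) t
  /-- A vertex whose two incident edges are parallel (interior angle 180 degrees) is not determined
  by the incidences; it does not slide along the edges, i.e. it moves perpendicularly to them. -/
  tangential : ∀ j, (inwardNormal p (K.label (j + 1)) = inwardNormal p (K.label j) ∨
      inwardNormal p (K.label (j + 1)) = -inwardNormal p (K.label j)) →
    ∀ t ∈ Icc a b, K.vertex t (j + 1) = K.vertex a (j + 1) +
      (offset δ (K.label j) t - offset δ (K.label j) a) • inwardNormal p (K.label j)

end MovingPolygon

/-- The union of all edges of the moving polygon `K` at time `t` that emanate from `e`. -/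
def fragments (K : MovingPolygon (ZMod n)) (e : ZMod n) (t : ℝ) : Set Plane :=
  ⋃ j, ⋃ (_ : K.label j = e), edge (K.vertex t) j

/-- Restoring planarity at time `t`: the wavefront polygon `K`, which may have degenerated at time
`t`, is replaced by the (possibly empty) list `L` of wavefront polygons. -/
structure Resolves (p : ZMod n → Plane) (δ : ZMod n → ℝ) (t : ℝ)
    (K : MovingPolygon (ZMod n)) (L : List (MovingPolygon (ZMod n))) : Prop where
  /-- Up to finitely many points, the boundary is kept, except that the portions common to two
  edges which have moved into each other from opposite sides are removed. (In particular edges of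
  length zero disappear, and the polygon is split where its boundary touches itself.) -/
  boundary : ∀ e,
    (symmDiff (⋃ K' ∈ L, ⋃ e' ∈ {e' | inwardNormal p e' = inwardNormal p e}, fragments K' e' t)
      ((⋃ e' ∈ {e' | inwardNormal p e' = inwardNormal p e}, fragments K e' t) \
        ⋃ e' ∈ {e' | inwardNormal p e' = -inwardNormal p e}, fragments K e' t)).Finite
  /-- A new edge with label `e` contains a piece of an old edge with label `e`. -/
  label_old : ∀ K' ∈ L, ∀ j, (edge (K'.vertex t) j ∩ fragments K (K'.label j) t).Infinite
  /-- A new edge with label `e` contains no piece of an old edge with another label `e'` and the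
  same inward normal, unless `e` or `e'` starts to move at time `t` or earlier: when collinear
  edges are adjacent and do not move alike, one of them takes over the other. -/
  label_other : ∀ K' ∈ L, ∀ j, ∀ e', e' ≠ K'.label j →
    inwardNormal p e' = inwardNormal p (K'.label j) →
    (edge (K'.vertex t) j ∩ fragments K e' t).Infinite → δ (K'.label j) ≤ t ∨ δ e' ≤ t

/-! ### The propagation process -/

/-- A wavefront propagation of the simple polygon `p` with additive weights `δ`: finitely many
events at times `0 = time 0 ≤ time 1 ≤ ⋯ ≤ time N`. From `time i` on and before `time (i + 1)` the
wavefront consists of the polygons in the list `polygons i`. -/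
structure Propagation (p : ZMod n → Plane) (δ : ZMod n → ℝ) where
  N : ℕ
  time : ℕ → ℝ
  polygons : ℕ → List (MovingPolygon (ZMod n))
  time_zero : time 0 = 0
  time_le : ∀ i < N, time i ≤ time (i + 1)
  /-- Initially the wavefront is the polygon `p`, and each edge emanates from itself. -/
  initial : ∃ v : ℝ → ZMod n → Plane, polygons 0 = [⟨n, id, v⟩] ∧ v 0 = p
  /-- Between events the polygons move. -/
  moves : ∀ i < N, ∀ K ∈ polygons i, K.MovesBetween p δ (time i) (time (i + 1))
  /-- At events planarity is restored: each polygon is replaced by finitely many polygons. -/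
  event : ∀ i < N, ∃ successors : MovingPolygon (ZMod n) → List (MovingPolygon (ZMod n)),
    (∀ K ∈ polygons i, Resolves p δ (time (i + 1)) K (successors K)) ∧
      polygons (i + 1) = (polygons i).flatMap successors
  /-- The process ends when all wavefront polygons have collapsed. -/
  final : polygons N = []

/-- The wavefront at time `t`, as the closed subset of the plane covered by the wavefront
polygons at time `t`. It is empty after the end of the process. -/
def Propagation.wavefront {p : ZMod n → Plane} {δ : ZMod n → ℝ} (W : Propagation p δ) (t : ℝ) :
    Set Plane :=
  {x | ∃ i < W.N, W.time i ≤ t ∧ t < W.time (i + 1) ∧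
    ∃ K ∈ W.polygons i, x ∈ region (K.vertex t)}

end StraightSkeleton

end

/-!
Call the curve of a wavefront polygon together with the bounded components of its complement its
region. A wavefront edge moves in the direction of its inward normal, so at any time `τ` each point
of the wavefront curve lies in the regions at all times shortly before `τ`, also if `τ` is an event
and the polygon has degenerated. Hence no region gains a point: if `x` is outside of the region at
some time, then there is a path from `x` to infinity that avoids the wavefront curve, and the first
later time at which the curve hits this path would contradict the previous sentence. An event only
removes portions of the boundary, up to finitely many points, so it does not enlarge the region
either.

The inclusion is not proper for a triangle all of whose edges wait until time `1`.
-/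

noncomputable section

namespace StraightSkeleton

section Filling

section TopologicalSpace

variable {X : Type*} [TopologicalSpace X] [Bornology X] {C D S : Set X} {x y : X}

/-- The set `C` together with the bounded components of its complement. The region of a polygon is
the filling of its boundary curve. -/
def filling (C : Set X) : Set X :=
  C ∪ {x | x ∉ C ∧ Bornology.IsBounded (connectedComponentIn Cᶜ x)}

theorem subset_filling (C : Set X) : C ⊆ filling C := subset_union_left

theorem notMem_filling_of_not_isBounded (hS : IsPreconnected S) (hSC : Disjoint S C)
    (hSb : ¬ Bornology.IsBounded S) (hx : x ∈ S) : x ∉ filling C := by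
  rintro (hxC | ⟨-, hb⟩)
  · exact hSC.notMem_of_mem_left hx hxC
  · exact hSb (hb.subset (hS.subset_connectedComponentIn hx hSC.subset_compl_right))

theorem mem_filling_of_isPreconnected (hS : IsPreconnected S) (hSC : Disjoint S C) (hx : x ∈ S)
    (hy : y ∈ S) (h : x ∈ filling C) : y ∈ filling C := by
  obtain ⟨-, hb⟩ := h.resolve_left (hSC.notMem_of_mem_left hx)
  refine Or.inr ⟨hSC.notMem_of_mem_left hy, ?_⟩
  rwa [← connectedComponentIn_eq (hS.subset_connectedComponentIn hx hSC.subset_compl_right hy)]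

theorem not_isBounded_connectedComponentIn (hx : x ∉ filling C) :
    ¬ Bornology.IsBounded (connectedComponentIn Cᶜ x) :=
  fun hb => hx (Or.inr ⟨fun hxC => hx (Or.inl hxC), hb⟩)

theorem disjoint_connectedComponentIn_filling (hx : x ∉ filling C) :
    Disjoint (connectedComponentIn Cᶜ x) (filling C) :=
  disjoint_left.2 fun _ => notMem_filling_of_not_isBounded isPreconnected_connectedComponentIn
    (subset_compl_iff_disjoint_right.1 (connectedComponentIn_subset _ _))
    (not_isBounded_connectedComponentIn hx)

theorem mem_connectedComponentIn_compl (hx : x ∉ filling C) : x ∈ connectedComponentIn Cᶜ x :=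
  mem_connectedComponentIn fun hxC => hx (subset_filling C hxC)

theorem filling_subset_filling (h : D ⊆ filling C) : filling D ⊆ filling C := by
  intro x hxD
  by_contra hx
  exact notMem_filling_of_not_isBounded isPreconnected_connectedComponentIn
    ((disjoint_connectedComponentIn_filling hx).mono_right h)
    (not_isBounded_connectedComponentIn hx) (mem_connectedComponentIn_compl hx) hxD

theorem isClosed_filling [LocallyConnectedSpace X] (hC : IsClosed C) : IsClosed (filling C) := by
  refine isOpen_compl_iff.1 (isOpen_iff_mem_nhds.2 fun x hx => ?_)
  exact mem_of_superset
    (hC.isOpen_compl.connectedComponentIn.mem_nhds (mem_connectedComponentIn_compl hx))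
    (disjoint_connectedComponentIn_filling hx).subset_compl_right

theorem subset_filling_of_frontier_subset (hS : Bornology.IsBounded S) (h : frontier S ⊆ C) :
    S ⊆ filling C := by
  intro x hxS
  by_cases hxC : x ∈ C
  · exact subset_filling C hxC
  refine Or.inr ⟨hxC, hS.subset ?_⟩
  have hcover : connectedComponentIn Cᶜ x ⊆ interior S ∪ (closure S)ᶜ := fun y hy => by
    by_contra hyS
    simp only [mem_union, mem_compl_iff, not_or, not_not] at hyS
    exact connectedComponentIn_subset _ _ hy (h ⟨hyS.2, hyS.1⟩)
  have hxint : x ∈ interior S := by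
    by_contra hx
    exact hxC (h ⟨subset_closure hxS, hx⟩)
  exact (isPreconnected_connectedComponentIn.subset_left_of_subset_union isOpen_interior
    isClosed_closure.isOpen_compl (disjoint_compl_right.mono_left interior_subset_closure) hcover
    ⟨x, mem_connectedComponentIn hxC, hxint⟩).trans interior_subset

end TopologicalSpace

section NormedSpace

variable {E : Type*} [NormedAddCommGroup E] [NormedSpace ℝ E] {C : Set E} {x w : E}

theorem not_isBounded_ray (hw : w ≠ 0) :
    ¬ Bornology.IsBounded ((fun r : ℝ => x + r • w) '' Ici 0) := by
  intro hb
  obtain ⟨R, hR⟩ := hb.exists_norm_le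
  have hr : 0 ≤ (|R| + ‖x‖ + 1) / ‖w‖ := by positivity
  have hle : ‖((|R| + ‖x‖ + 1) / ‖w‖) • w‖ ≤ ‖x + ((|R| + ‖x‖ + 1) / ‖w‖) • w‖ + ‖x‖ := by
    simpa only [add_sub_cancel_left] using norm_sub_le (x + ((|R| + ‖x‖ + 1) / ‖w‖) • w) x
  rw [norm_smul, Real.norm_of_nonneg hr, div_mul_cancel₀ _ (norm_ne_zero_iff.2 hw)] at hle
  linarith [hR _ (mem_image_of_mem _ hr), le_abs_self R]

theorem notMem_filling_of_ray (hw : w ≠ 0) (h : ∀ r : ℝ, 0 ≤ r → x + r • w ∉ C) :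
    x ∉ filling C := by
  refine notMem_filling_of_not_isBounded (isPreconnected_Ici.image _ (by fun_prop)) ?_
    (not_isBounded_ray (x := x) hw) ⟨0, self_mem_Ici, by simp⟩
  refine disjoint_left.2 ?_
  rintro _ ⟨r, hr, rfl⟩
  exact h r hr

theorem notMem_filling_of_forall_norm_lt (hx : x ≠ 0) (h : ∀ y ∈ C, ‖y‖ < ‖x‖) :
    x ∉ filling C := by
  refine notMem_filling_of_ray hx fun r hr hC => (h _ hC).not_ge ?_
  rw [show x + r • x = (1 + r) • x by rw [add_smul, one_smul], norm_smul,
    Real.norm_of_nonneg (by positivity)]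
  nlinarith [norm_nonneg x]

theorem exists_path_disjoint_filling (hC : IsClosed C) (hx : x ∉ filling C) (M : ℝ) :
    ∃ z, ∃ γ : Path x z, M < ‖z‖ ∧ Disjoint (range γ) (filling C) := by
  obtain ⟨z, hzV, hzM⟩ : ∃ z ∈ connectedComponentIn Cᶜ x, M < ‖z‖ := by
    by_contra! hle
    exact not_isBounded_connectedComponentIn hx (isBounded_iff_forall_norm_le.2 ⟨M, hle⟩)
  have hxV := mem_connectedComponentIn_compl hx
  have hV : IsPathConnected (connectedComponentIn Cᶜ x) :=
    hC.isOpen_compl.connectedComponentIn.isConnected_iff_isPathConnected.1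
      ⟨⟨x, hxV⟩, isPreconnected_connectedComponentIn⟩
  obtain ⟨γ, hγ⟩ := hV.joinedIn x hxV z hzV
  exact ⟨z, γ, hzM, (disjoint_connectedComponentIn_filling hx).mono_left (range_subset_iff.2 hγ)⟩

/-- A path from infinity to a point outside the initial filling cannot be hit by `C` for a first
time, because the point where it is hit would have been enclosed by `C` just before. -/
theorem filling_subset_filling_of_frequently {C : ℝ → Set E} {s t : ℝ} (hst : s ≤ t)
    (hC : IsCompact {q : ℝ × E | q.1 ∈ Icc s t ∧ q.2 ∈ C q.1})
    (hin : ∀ τ ∈ Ioc s t, ∀ y ∈ C τ, ∃ᶠ r in 𝓝[<] τ, y ∈ filling (C r)) :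
    filling (C t) ⊆ filling (C s) := by
  intro x hxt
  by_contra hxs
  obtain ⟨M, hM⟩ := hC.isBounded.exists_norm_le
  have hCs : IsClosed (C s) := by
    simpa only [preimage_ofPred_eq, left_mem_Icc.2 hst, true_and, ofPred_mem_eq]
      using hC.isClosed.preimage (Continuous.prodMk_right s)
  obtain ⟨z, γ, hzM, hγs⟩ := exists_path_disjoint_filling hCs hxs |M|
  have hz₀ : z ≠ 0 := norm_pos_iff.1 ((abs_nonneg M).trans_lt hzM)
  have hz : ∀ r ∈ Icc s t, z ∉ filling (C r) := fun r hr =>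
    notMem_filling_of_forall_norm_lt hz₀ fun y hy =>
      ((norm_snd_le (r, y)).trans (hM _ ⟨hr, hy⟩)).trans_lt ((le_abs_self M).trans_lt hzM)
  have hγ : ∀ r ∈ Icc s t, Disjoint (range γ) (C r) → ∀ y ∈ range γ, y ∉ filling (C r) :=
    fun r hr hd y hy hyr => hz r hr <|
      mem_filling_of_isPreconnected (isPreconnected_range γ.continuous) hd hy γ.target_mem_range hyr
  set T : Set ℝ := Prod.fst '' ({q : ℝ × E | q.1 ∈ Icc s t ∧ q.2 ∈ C q.1} ∩ Prod.snd ⁻¹' range γ)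
  have hT : IsCompact T := (hC.inter_right
    ((isCompact_range γ.continuous).isClosed.preimage continuous_snd)).image continuous_fst
  have mem_T : ∀ r ∈ Icc s t, ¬ Disjoint (range γ) (C r) → r ∈ T := fun r hr hd => by
    obtain ⟨y, hy, hyr⟩ := not_disjoint_iff.1 hd
    exact ⟨(r, y), ⟨⟨hr, hyr⟩, hy⟩, rfl⟩
  have ht : t ∈ T := mem_T t (right_mem_Icc.2 hst) fun hd =>
    hγ t (right_mem_Icc.2 hst) hd x γ.source_mem_range hxt
  obtain ⟨τ, ⟨⟨τ, y⟩, ⟨⟨hτ, hyτ⟩, hyγ⟩, rfl⟩, hfirst⟩ := hT.exists_isLeast ⟨t, ht⟩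
  have hsτ : s < τ := hτ.1.lt_of_ne <| by
    rintro rfl
    exact hγs.notMem_of_mem_left hyγ (subset_filling _ hyτ)
  obtain ⟨r, hyr, hr⟩ := ((hin τ ⟨hsτ, hτ.2⟩ y hyτ).and_eventually (Ioo_mem_nhdsLT hsτ)).exists
  have hrI : r ∈ Icc s t := ⟨hr.1.le, hr.2.le.trans hτ.2⟩
  refine hγ r hrI (not_not.1 fun hd => ?_) y hyγ hyr
  exact (hfirst (mem_T r hrI hd)).not_gt hr.2

end NormedSpace

end Filling

section InnerProductSpace

open Module
open scoped RealInnerProductSpace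

variable {E : Type*} [NormedAddCommGroup E] [InnerProductSpace ℝ E]
  {C U : Set E} {a b c d q x y z u w ν ν₁ ν₂ : E} {r : ℝ}

theorem convex_setOf_inner_le (ν : E) (r : ℝ) : Convex ℝ {x | ⟪ν, x⟫ ≤ r} :=
  (convex_Iic r).linear_preimage (innerₗ E ν)

theorem convex_setOf_lt_inner (ν : E) (r : ℝ) : Convex ℝ {x | r < ⟪ν, x⟫} :=
  (convex_Ioi r).linear_preimage (innerₗ E ν)

theorem inner_eq_of_mem_segment (h : ⟪ν, b⟫ = ⟪ν, a⟫) (hq : q ∈ segment ℝ a b) :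
    ⟪ν, q⟫ = ⟪ν, a⟫ :=
  ((convex_singleton ⟪ν, a⟫).linear_preimage (innerₗ E ν)).segment_subset rfl h hq

theorem eq_right_of_mem_segment (hx : x ∈ segment ℝ a b) (ha : r < ⟪ν, a⟫) (hb : r ≤ ⟪ν, b⟫)
    (hxr : ⟪ν, x⟫ = r) : x = b := by
  obtain ⟨s, t, hs, ht, hst, rfl⟩ := hx
  rw [inner_add_right, inner_smul_right, inner_smul_right] at hxr
  obtain rfl : t = 1 - s := by linarith
  obtain rfl : s = 0 := by
    by_contra hs₀
    nlinarith [mul_pos (hs.lt_of_ne' hs₀) (sub_pos.2 ha), mul_nonneg ht (sub_nonneg.2 hb)]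
  rw [zero_smul, zero_add, sub_zero, one_smul]

theorem exists_mem_openSegment_inter (hU : IsOpen U) (hc : c ∈ segment ℝ a b) (hcU : c ∈ U) :
    ∃ z ∈ openSegment ℝ a b, z ∈ U := by
  obtain ⟨z, hzU, hz⟩ := mem_closure_iff.1 (segment_subset_closure_openSegment hc) U hU hcU
  exact ⟨z, hz, hzU⟩

theorem mem_segment_of_sameRay (hU : Convex ℝ U) (hc : c ∈ U) (hy : y ∈ U) (hd : d ∉ U)
    (h : SameRay ℝ (y - c) (d - c)) : y ∈ segment ℝ c d := by
  rcases wbtw_total_of_sameRay_vsub_left (x := c) (y := y) (z := d) h with hw | hw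
  · exact mem_segment_iff_wbtw.2 hw
  · exact absurd (hU.segment_subset hc hy (mem_segment_iff_wbtw.2 hw)) hd

theorem le_inner_of_mem_filling (hν : ν ≠ 0) (h : ∀ y ∈ C, r ≤ ⟪ν, y⟫) (hx : x ∈ filling C) :
    r ≤ ⟪ν, x⟫ := by
  by_contra! hxr
  refine notMem_filling_of_ray (neg_ne_zero.2 hν) (fun s hs hC => (h _ hC).not_gt ?_) hx
  rw [inner_add_right, inner_smul_right, inner_neg_right]
  nlinarith [real_inner_self_nonneg (x := ν)]

/-- Moving from `z` in the direction of `ν` one enters the convex set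
`{q ∈ U | ⟪ν, z⟫ < ⟪ν, q⟫}`, which avoids `C`. -/
theorem mem_filling_of_eventually_add_smul_mem (hν : ν ≠ 0)
    (hz : ∀ᶠ ε in 𝓝[>] (0 : ℝ), z + ε • ν ∈ filling C) (hUo : IsOpen U) (hUc : Convex ℝ U)
    (hzU : z ∈ U) (hC : ∀ q ∈ C ∩ U, ⟪ν, q⟫ ≤ ⟪ν, z⟫) (hy : y ∈ U)
    (hzy : ⟪ν, z⟫ < ⟪ν, y⟫) : y ∈ filling C := by
  have hlim : Tendsto (fun ε : ℝ => z + ε • ν) (𝓝[>] 0) (𝓝 z) :=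
    tendsto_nhdsWithin_of_tendsto_nhds (Continuous.tendsto' (by fun_prop) _ _ (by simp))
  obtain ⟨ε, hεC, hεU, hε : 0 < ε⟩ :=
    (hz.and ((hlim.eventually_mem (hUo.mem_nhds hzU)).and self_mem_nhdsWithin)).exists
  refine mem_filling_of_isPreconnected
    (hUc.inter (convex_setOf_lt_inner ν ⟪ν, z⟫)).isPreconnected
    (disjoint_left.2 fun q hq hqC => (hC q ⟨hqC, hq.1⟩).not_gt hq.2) ⟨hεU, ?_⟩ ⟨hy, hzy⟩ hεC
  have : 0 < ε * ⟪ν, ν⟫ := mul_pos hε (real_inner_self_pos.2 hν)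
  simpa only [mem_ofPred_eq, inner_add_right, inner_smul_right, lt_add_iff_pos_right] using this

/-- The segment from `c` to `a` is a piece of `C` leaving the neighbourhood `U` of `c`, orthogonal
to `ν`, and `ν` points from it into the filling of `C`. Around a point `c` of a polygon the curve
consists of two such arms; inside an edge they have the same normal `ν`. -/
structure IsInwardArm (C U : Set E) (c a ν : E) : Prop where
  segment_subset : segment ℝ c a ⊆ C
  notMem : a ∉ U
  inner_eq : ⟪ν, a⟫ = ⟪ν, c⟫
  ne_zero : ν ≠ 0
  inward : ∀ x ∈ openSegment ℝ c a, ∀ᶠ ε in 𝓝[>] (0 : ℝ), x + ε • ν ∈ filling C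

namespace IsInwardArm

theorem mem_filling_of_halfPlane (h₁ : IsInwardArm C U c a ν₁)
    (hC : C ∩ U ⊆ segment ℝ c a ∪ segment ℝ c b) (hUo : IsOpen U) (hUc : Convex ℝ U)
    (hcU : c ∈ U) (hy : y ∈ U) (hb : ⟪ν₁, b⟫ ≤ ⟪ν₁, c⟫) (hy₁ : ⟪ν₁, c⟫ < ⟪ν₁, y⟫) :
    y ∈ filling C := by
  obtain ⟨z, hz, hzU⟩ := exists_mem_openSegment_inter hUo (left_mem_segment ℝ c a) hcU
  have hzc := inner_eq_of_mem_segment h₁.inner_eq (openSegment_subset_segment ℝ _ _ hz)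
  refine mem_filling_of_eventually_add_smul_mem h₁.ne_zero (h₁.inward z hz) hUo hUc hzU
    (fun q hq => ?_) hy (hzc ▸ hy₁)
  have hconv := convex_setOf_inner_le ν₁ ⟪ν₁, c⟫
  rw [hzc]
  rcases hC hq with hqa | hqb
  · exact hconv.segment_subset (le_refl ⟪ν₁, c⟫) h₁.inner_eq.le hqa
  · exact hconv.segment_subset (le_refl ⟪ν₁, c⟫) hb hqb

theorem mem_filling_of_wedge (h₁ : IsInwardArm C U c a ν₁) (h₂ : IsInwardArm C U c b ν₂)
    (hC : C ∩ U ⊆ segment ℝ c a ∪ segment ℝ c b) (hUo : IsOpen U) (hUc : Convex ℝ U)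
    (hcU : c ∈ U) (hy : y ∈ U) (ha : ⟪ν₂, c⟫ < ⟪ν₂, a⟫) (hy₁ : ⟪ν₁, c⟫ < ⟪ν₁, y⟫)
    (hy₂ : ⟪ν₂, c⟫ < ⟪ν₂, y⟫) : y ∈ filling C := by
  obtain ⟨z, hz, hzU⟩ := exists_mem_openSegment_inter hUo (left_mem_segment ℝ c a) hcU
  have hzc := inner_eq_of_mem_segment h₁.inner_eq (openSegment_subset_segment ℝ _ _ hz)
  have hz₂ : ⟪ν₂, c⟫ < ⟪ν₂, z⟫ := by
    obtain ⟨s, t, hs, ht, hst, rfl⟩ := hz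
    obtain rfl : s = 1 - t := by linarith
    rw [inner_add_right, inner_smul_right, inner_smul_right]
    linarith [mul_pos ht (sub_pos.2 ha)]
  refine mem_filling_of_eventually_add_smul_mem h₁.ne_zero (h₁.inward z hz)
    (hUo.inter (isOpen_lt (f := fun _ => ⟪ν₂, c⟫) (g := fun q => ⟪ν₂, q⟫) (by fun_prop)
      (by fun_prop))) (hUc.inter (convex_setOf_lt_inner ν₂ _)) ⟨hzU, hz₂⟩ ?_ ⟨hy, hy₂⟩ (hzc ▸ hy₁)
  rintro q ⟨hqC, hqU, hq₂⟩
  rcases hC ⟨hqC, hqU⟩ with hqa | hqb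
  · rw [hzc, inner_eq_of_mem_segment h₁.inner_eq hqa]
  · exact absurd (inner_eq_of_mem_segment h₂.inner_eq hqb) (ne_of_gt hq₂)

end IsInwardArm

section TwoDim

variable [Fact (finrank ℝ E = 2)]

theorem exists_smul_eq_of_inner_eq_zero (hν : ν ≠ 0) (hw : w ≠ 0) (hu : ⟪ν, u⟫ = 0)
    (hwν : ⟪ν, w⟫ = 0) : ∃ r : ℝ, r • w = u :=
  Submodule.mem_span_singleton.1
    (Submodule.mem_span_singleton_of_inner_eq_zero_of_inner_eq_zero hν hw hu hwν)

theorem eq_or_eq_neg_of_norm_eq_one (hu : u ≠ 0) (hν₁ : ‖ν₁‖ = 1) (hν₂ : ‖ν₂‖ = 1)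
    (h₁ : ⟪u, ν₁⟫ = 0) (h₂ : ⟪u, ν₂⟫ = 0) : ν₂ = ν₁ ∨ ν₂ = -ν₁ := by
  obtain ⟨r, rfl⟩ := exists_smul_eq_of_inner_eq_zero hu (norm_ne_zero_iff.1 (by simp [hν₁])) h₂ h₁
  rw [norm_smul, hν₁, mul_one, Real.norm_eq_abs] at hν₂
  rcases eq_or_eq_neg_of_abs_eq hν₂ with rfl | rfl <;> simp

theorem exists_continuous_inner_leftInverse (hν₁ : ‖ν₁‖ = 1) (hν₂ : ‖ν₂‖ = 1) (hne : ν₂ ≠ ν₁)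
    (hneg : ν₂ ≠ -ν₁) : ∃ g : ℝ × ℝ → E, Continuous g ∧ ∀ x, g (⟪ν₁, x⟫, ⟪ν₂, x⟫) = x := by
  let f : E →ₗ[ℝ] ℝ × ℝ := (innerₛₗ ℝ ν₁).prod (innerₛₗ ℝ ν₂)
  have hker : LinearMap.ker f = ⊥ := by
    refine LinearMap.ker_eq_bot'.2 fun x hx => ?_
    by_contra hx₀
    obtain ⟨h₁, h₂⟩ := Prod.ext_iff.1 hx
    exact (eq_or_eq_neg_of_norm_eq_one hx₀ hν₁ hν₂ ((real_inner_comm _ _).trans h₁)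
      ((real_inner_comm _ _).trans h₂)).elim hne hneg
  obtain ⟨g, hg⟩ := f.exists_leftInverse_of_injective hker
  exact ⟨g, g.continuous_of_finiteDimensional, LinearMap.congr_fun hg⟩

theorem mem_segment_of_inner_lt (hν₂ : ν₂ ≠ 0) (hU : Convex ℝ U) (hc : c ∈ U) (hy : y ∈ U)
    (hb : b ∉ U) (hb₂ : ⟪ν₂, b⟫ = ⟪ν₂, c⟫) (hy₂ : ⟪ν₂, y⟫ = ⟪ν₂, c⟫)
    (hb₁ : ⟪ν₁, c⟫ < ⟪ν₁, b⟫) (hy₁ : ⟪ν₁, c⟫ < ⟪ν₁, y⟫) : y ∈ segment ℝ c b := by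
  have hbc : b - c ≠ 0 := sub_ne_zero.2 fun h => hb (h ▸ hc)
  obtain ⟨r, hr⟩ := exists_smul_eq_of_inner_eq_zero hν₂ hbc
    (u := y - c) (by rw [inner_sub_right, hy₂, sub_self]) (by rw [inner_sub_right, hb₂, sub_self])
  refine mem_segment_of_sameRay hU hc hy hb (hr ▸ SameRay.sameRay_nonneg_smul_left _ ?_)
  have hr₁ : r * ⟪ν₁, b - c⟫ = ⟪ν₁, y - c⟫ := by rw [← hr, inner_smul_right]
  rw [inner_sub_right, inner_sub_right] at hr₁
  exact (pos_of_mul_pos_left (hr₁ ▸ sub_pos.2 hy₁) (sub_pos.2 hb₁).le).le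

theorem mem_segment_of_inner_eq (hν : ν ≠ 0) (hU : Convex ℝ U) (hc : c ∈ U)
    (hcab : c ∈ segment ℝ a b) (ha : a ∉ U) (hb : b ∉ U) (hab : ⟪ν, b⟫ = ⟪ν, a⟫) (hy : y ∈ U)
    (hyc : ⟪ν, y⟫ = ⟪ν, c⟫) : y ∈ segment ℝ a b := by
  have hbc : b - c ≠ 0 := sub_ne_zero.2 fun h => hb (h ▸ hc)
  have hca := inner_eq_of_mem_segment hab hcab
  obtain ⟨r, hr⟩ := exists_smul_eq_of_inner_eq_zero hν hbc (u := y - c)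
    (by rw [inner_sub_right, hyc, sub_self]) (by rw [inner_sub_right, hab, hca, sub_self])
  have hseg := convex_segment (𝕜 := ℝ) a b
  rcases le_total 0 r with hr₀ | hr₀
  · exact hseg.segment_subset hcab (right_mem_segment ℝ a b) <|
      mem_segment_of_sameRay hU hc hy hb (hr ▸ SameRay.sameRay_nonneg_smul_left _ hr₀)
  · have hray : SameRay ℝ (a - c) (c - b) := by
      simpa only [vsub_eq_sub, neg_sub] using (mem_segment_iff_wbtw.1 hcab).sameRay_vsub.neg
    have hray' : SameRay ℝ (y - c) (c - b) := by
      rw [← hr, ← neg_sub c b, smul_neg, ← neg_smul]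
      exact SameRay.sameRay_nonneg_smul_left _ (neg_nonneg.2 hr₀)
    exact hseg.segment_subset hcab (left_mem_segment ℝ a b) <| mem_segment_of_sameRay hU hc hy ha <|
      hray'.trans hray.symm fun h => absurd (neg_eq_zero.2 h) (by rwa [neg_sub])

namespace IsInwardArm

theorem mem_filling_of_lt_of_eq (h₁ : IsInwardArm C U c a ν₁) (h₂ : IsInwardArm C U c b ν₂)
    (hC : C ∩ U ⊆ segment ℝ c a ∪ segment ℝ c b) (hUo : IsOpen U) (hUc : Convex ℝ U)
    (hcU : c ∈ U) (hy : y ∈ U) (hy₁ : ⟪ν₁, c⟫ < ⟪ν₁, y⟫) (hy₂ : ⟪ν₂, c⟫ = ⟪ν₂, y⟫) :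
    y ∈ filling C := by
  rcases le_or_gt ⟪ν₁, b⟫ ⟪ν₁, c⟫ with hb | hb
  · exact h₁.mem_filling_of_halfPlane hC hUo hUc hcU hy hb hy₁
  · exact subset_filling C (h₂.segment_subset
      (mem_segment_of_inner_lt h₂.ne_zero hUc hcU hy h₂.notMem h₂.inner_eq hy₂.symm hb hy₁))

theorem mem_filling (h₁ : IsInwardArm C U c a ν₁) (h₂ : IsInwardArm C U c b ν₂)
    (hC : C ∩ U ⊆ segment ℝ c a ∪ segment ℝ c b) (hUo : IsOpen U) (hUc : Convex ℝ U)
    (hcU : c ∈ U) (hy : y ∈ U) (hy₁ : ⟪ν₁, c⟫ ≤ ⟪ν₁, y⟫) (hy₂ : ⟪ν₂, c⟫ ≤ ⟪ν₂, y⟫)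
    (heq : ⟪ν₁, c⟫ = ⟪ν₁, y⟫ → ⟪ν₂, c⟫ = ⟪ν₂, y⟫ → y ∈ C) : y ∈ filling C := by
  have hC' : C ∩ U ⊆ segment ℝ c b ∪ segment ℝ c a := by rwa [union_comm]
  rcases hy₁.lt_or_eq with lt₁ | eq₁ <;> rcases hy₂.lt_or_eq with lt₂ | eq₂
  · rcases le_or_gt ⟪ν₂, a⟫ ⟪ν₂, c⟫ with ha | ha
    · exact h₂.mem_filling_of_halfPlane hC' hUo hUc hcU hy ha lt₂
    · exact h₁.mem_filling_of_wedge h₂ hC hUo hUc hcU hy ha lt₁ lt₂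
  · exact h₁.mem_filling_of_lt_of_eq h₂ hC hUo hUc hcU hy lt₁ eq₂
  · exact h₂.mem_filling_of_lt_of_eq h₁ hC' hUo hUc hcU hy lt₂ eq₁
  · exact subset_filling C (heq eq₁ eq₂)

end IsInwardArm

end TwoDim

end InnerProductSpace

section Segment

variable {E : Type*} [AddCommGroup E] [Module ℝ E] {a b c : E}

theorem segment_subset_union_of_mem (hc : c ∈ segment ℝ a b) :
    segment ℝ a b ⊆ segment ℝ c a ∪ segment ℝ c b := by
  rw [segment_eq_image_lineMap] at hc
  obtain ⟨r, hr, rfl⟩ := hc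
  rw [segment_eq_image_lineMap ℝ a b]
  rintro _ ⟨s, hs, rfl⟩
  have himage (u : ℝ) (hsu : s ∈ segment ℝ r u) :
      AffineMap.lineMap a b s ∈ segment ℝ (AffineMap.lineMap a b r) (AffineMap.lineMap a b u) :=
    image_segment ℝ (AffineMap.lineMap a b) r u ▸ mem_image_of_mem _ hsu
  rcases le_total s r with hsr | hrs
  · have hs₀ : s ∈ segment ℝ r 0 := by
      rw [segment_symm, segment_eq_Icc hr.1]
      exact ⟨hs.1, hsr⟩
    exact Or.inl (by simpa only [AffineMap.lineMap_apply_zero] using himage 0 hs₀)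
  · have hs₁ : s ∈ segment ℝ r 1 := by
      rw [segment_eq_Icc hr.2]
      exact ⟨hrs, hs.2⟩
    exact Or.inr (by simpa only [AffineMap.lineMap_apply_one] using himage 1 hs₁)

theorem openSegment_subset_openSegment_of_mem (hc : c ∈ segment ℝ a b) (hcb : c ≠ b) :
    openSegment ℝ c b ⊆ openSegment ℝ a b := by
  obtain ⟨r, s, hr, hs, hrs, rfl⟩ := hc
  have hr₀ : 0 < r := hr.lt_of_ne <| by
    rintro rfl
    obtain rfl : s = 1 := by linarith
    exact hcb (by rw [zero_smul, zero_add, one_smul])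
  rintro _ ⟨t, u, ht, hu, htu, rfl⟩
  refine ⟨t * r, t * s + u, by positivity, by positivity, ?_, by module⟩
  linear_combination t * hrs + htu

end Segment

section Polygon

variable {n : ℕ} {v : ZMod n → Plane} {j k : ZMod n} {x : Plane}

theorem edge_subset_curve (v : ZMod n → Plane) (j : ZMod n) : edge v j ⊆ curve v :=
  subset_iUnion _ j

theorem vertex_mem_edge_sub_one (v : ZMod n → Plane) (j : ZMod n) : v j ∈ edge v (j - 1) := by
  rw [edge, sub_add_cancel]
  exact right_mem_segment ℝ _ _

theorem isCompact_edge (v : ZMod n → Plane) (j : ZMod n) : IsCompact (edge v j) := by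
  rw [edge, segment_eq_image_lineMap]
  exact isCompact_Icc.image AffineMap.lineMap_continuous

theorem isClosed_curve [NeZero n] (v : ZMod n → Plane) : IsClosed (curve v) :=
  isClosed_iUnion_of_finite fun j => (isCompact_edge v j).isClosed

theorem curve_subset_region (v : ZMod n → Plane) : curve v ⊆ region v := subset_filling _

theorem isClosed_region [NeZero n] (v : ZMod n → Plane) : IsClosed (region v) :=
  isClosed_filling (isClosed_curve v)

namespace IsSimplePolygon

theorem neZero (h : IsSimplePolygon v) : NeZero n :=
  ⟨by have := h.three_le; omega⟩

theorem notMem_edge (h : IsSimplePolygon v) (hx : x ∈ edge v j) (hkj : k ≠ j) (h₀ : x ≠ v j)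
    (h₁ : k ≠ j + 1 ∨ x ≠ v (j + 1)) : x ∉ edge v k := by
  intro hxk
  by_cases hk : k = j + 1
  · subst hk
    exact h₁.elim (absurd rfl) fun h₁ => h₁ ((h.consecutive j).subset ⟨hx, hxk⟩)
  by_cases hj : j = k + 1
  · subst hj
    exact h₀ ((h.consecutive k).subset ⟨hxk, hx⟩)
  · exact (h.nonconsecutive j k hkj hk hj).notMem_of_mem_left hx hxk

end IsSimplePolygon

theorem add_one_ne_self (hn : 3 ≤ n) (j : ZMod n) : j + 1 ≠ j := by
  have : Fact (1 < n) := ⟨by omega⟩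
  simp

theorem sub_one_ne_self (hn : 3 ≤ n) (j : ZMod n) : j - 1 ≠ j := fun h =>
  add_one_ne_self hn (j - 1) (by rw [sub_add_cancel, h])

theorem add_one_add_one_ne_self (hn : 3 ≤ n) (j : ZMod n) : j + 1 + 1 ≠ j := by
  rw [add_assoc, one_add_one_eq_two, Ne, add_eq_left, ← Nat.cast_two, ZMod.natCast_eq_zero_iff]
  exact fun h => absurd (Nat.le_of_dvd two_pos h) (by omega)

theorem sub_one_ne_add_one (hn : 3 ≤ n) (j : ZMod n) : j - 1 ≠ j + 1 := fun h =>
  add_one_add_one_ne_self hn (j - 1) (by rw [sub_add_cancel, h])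

theorem exists_ball_disjoint_edge [NeZero n] {ι : Type*} {l : Filter ι} {u : ι → ZMod n → Plane}
    (hu : ∀ k, Tendsto (fun i => u i k) l (𝓝 (v k))) {S : Set (ZMod n)}
    (hx : ∀ k ∉ S, x ∉ edge v k) :
    ∃ ρ > 0, ∀ᶠ i in l, ∀ k ∉ S, Disjoint (Metric.ball x ρ) (edge (u i) k) := by
  have hclosed : IsClosed (⋃ k ∈ Sᶜ, edge v k) :=
    Sᶜ.toFinite.isClosed_biUnion fun k _ => (isCompact_edge v k).isClosed
  have hdisj : Disjoint {x} (⋃ k ∈ Sᶜ, edge v k) := by simpa using hx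
  obtain ⟨ρ, hρ, hthick⟩ := hdisj.exists_thickenings isCompact_singleton hclosed
  rw [Metric.thickening_singleton] at hthick
  have hnear : ∀ᶠ i in l, ∀ k, u i k ∈ Metric.ball (v k) ρ :=
    eventually_all.2 fun k => (hu k).eventually_mem (Metric.ball_mem_nhds _ hρ)
  refine ⟨ρ, hρ, hnear.mono fun i hi k hk => hthick.mono_right ?_⟩
  have hvertex : ∀ m, v m ∈ edge v k → u i m ∈ Metric.thickening ρ (edge v k) := fun m hm =>
    Metric.mem_thickening_iff.2 ⟨v m, hm, hi m⟩
  have hedge : edge (u i) k ⊆ Metric.thickening ρ (edge v k) :=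
    ((convex_segment (v k) (v (k + 1))).thickening ρ).segment_subset
      (hvertex k (left_mem_segment ℝ _ _)) (hvertex (k + 1) (right_mem_segment ℝ _ _))
  exact hedge.trans (Metric.thickening_subset_of_subset ρ (subset_biUnion_of_mem (u := edge v) hk))

theorem exists_mem_edge_of_disjoint {S : Set (ZMod n)} {U : Set Plane}
    (hU : ∀ k ∉ S, Disjoint U (edge v k)) (hx : x ∈ curve v ∩ U) : ∃ k ∈ S, x ∈ edge v k := by
  obtain ⟨k, hk⟩ := mem_iUnion.1 hx.1
  exact ⟨k, by_contra fun hkS => (hU k hkS).notMem_of_mem_left hx.2 hk, hk⟩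

theorem exists_tendsto_mem_edge {ι : Type*} {l : Filter ι} {u : ι → ZMod n → Plane}
    (hu : ∀ k, Tendsto (fun i => u i k) l (𝓝 (v k))) (hx : x ∈ edge v j) :
    ∃ c : ι → Plane, Tendsto c l (𝓝 x) ∧ ∀ i, c i ∈ edge (u i) j := by
  obtain ⟨r, hr, rfl⟩ := (segment_eq_image_lineMap ℝ _ _).subset hx
  exact ⟨fun i => AffineMap.lineMap (u i j) (u i (j + 1)) r,
    (hu j).lineMap (hu (j + 1)) tendsto_const_nhds,
    fun i => (segment_eq_image_lineMap ℝ _ _).superset ⟨r, hr, rfl⟩⟩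

theorem isCompact_setOf_mem_curve [NeZero n] {T : Type*} [TopologicalSpace T] {I : Set T}
    (hI : IsCompact I) {u : T → ZMod n → Plane} (hu : ∀ j, ContinuousOn (fun t => u t j) I) :
    IsCompact {q : T × Plane | q.1 ∈ I ∧ q.2 ∈ curve (u q.1)} := by
  have hcont (j : ZMod n) : ContinuousOn
      (fun q : T × ℝ => (q.1, u q.1 j + q.2 • (u q.1 (j + 1) - u q.1 j))) (I ×ˢ Icc 0 1) := by
    have hfst (k : ZMod n) : ContinuousOn (fun q : T × ℝ => u q.1 k) (I ×ˢ Icc 0 1) :=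
      (hu k).comp continuousOn_fst fun q hq => hq.1
    have hsnd := (hfst j).add (continuousOn_snd.smul ((hfst (j + 1)).sub (hfst j)))
    exact continuousOn_fst.prodMk hsnd
  have himage : {q : T × Plane | q.1 ∈ I ∧ q.2 ∈ curve (u q.1)} = ⋃ j,
      (fun q : T × ℝ => (q.1, u q.1 j + q.2 • (u q.1 (j + 1) - u q.1 j))) '' I ×ˢ Icc 0 1 := by
    ext ⟨t, y⟩
    simp only [curve, edge, segment_eq_image', mem_ofPred_eq, mem_iUnion]
    constructor
    · rintro ⟨ht, j, r, hr, rfl⟩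
      exact ⟨j, (t, r), ⟨ht, hr⟩, rfl⟩
    · rintro ⟨j, ⟨t, r⟩, ⟨ht, hr⟩, h⟩
      obtain ⟨rfl, rfl⟩ := Prod.ext_iff.1 h
      exact ⟨ht, j, r, hr, rfl⟩
  rw [himage]
  exact isCompact_iUnion fun j => (hI.prod isCompact_Icc).image_of_continuousOn (hcont j)

end Polygon

section InwardNormal

open scoped RealInnerProductSpace

variable {n : ℕ} {p : ZMod n → Plane} {δ : ZMod n → ℝ} {e : ZMod n} {t : ℝ} {y : Plane}

theorem norm_leftNormal {a b : Plane} (h : a ≠ b) : ‖leftNormal a b‖ = 1 := by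
  have hrot : ‖(!₂[-(b - a) 1, (b - a) 0] : Plane)‖ = ‖b - a‖ := by
    rw [EuclideanSpace.norm_eq, EuclideanSpace.norm_eq, Fin.sum_univ_two, Fin.sum_univ_two]
    congr 1
    simp only [Matrix.cons_val_zero, Matrix.cons_val_one, norm_neg]
    ring
  rw [leftNormal, norm_smul, hrot, norm_inv, norm_norm,
    inv_mul_cancel₀ (norm_ne_zero_iff.2 (sub_ne_zero.2 h.symm))]

theorem inner_leftNormal_sub (a b : Plane) : ⟪leftNormal a b, b - a⟫ = 0 := by
  rw [leftNormal, real_inner_smul_left, PiLp.inner_apply, Fin.sum_univ_two]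
  simp only [Matrix.cons_val_zero, Matrix.cons_val_one, RCLike.inner_apply, conj_trivial]
  ring

theorem norm_inwardNormal (he : p e ≠ p (e + 1)) : ‖inwardNormal p e‖ = 1 := by
  unfold inwardNormal
  split_ifs <;> simp only [norm_neg, norm_leftNormal he]

theorem inwardNormal_ne_zero (he : p e ≠ p (e + 1)) : inwardNormal p e ≠ 0 :=
  norm_ne_zero_iff.1 (by rw [norm_inwardNormal he]; exact one_ne_zero)

theorem inner_inwardNormal_sub (p : ZMod n → Plane) (e : ZMod n) :
    ⟪inwardNormal p e, p (e + 1) - p e⟫ = 0 := by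
  unfold inwardNormal
  split_ifs <;> simp only [inner_neg_left, inner_leftNormal_sub, neg_zero]

theorem continuous_offset (δ : ZMod n → ℝ) (e : ZMod n) : Continuous (offset δ e) := by
  unfold offset
  fun_prop

theorem monotone_offset (δ : ZMod n → ℝ) (e : ZMod n) : Monotone (offset δ e) :=
  fun _ _ h => max_le_max le_rfl (sub_le_sub_right h _)

/-- The height, in the direction of the inward normal of the edge `e`, of the supporting line of
`e` at time `t`: that line is `{y | ⟪n_e, y⟫ = level p δ e t}`. -/
def level (p : ZMod n → Plane) (δ : ZMod n → ℝ) (e : ZMod n) (t : ℝ) : ℝ :=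
  ⟪inwardNormal p e, p e⟫ + offset δ e t

theorem continuous_level (p : ZMod n → Plane) (δ : ZMod n → ℝ) (e : ZMod n) :
    Continuous (level p δ e) :=
  continuous_const.add (continuous_offset δ e)

theorem monotone_level (p : ZMod n → Plane) (δ : ZMod n → ℝ) (e : ZMod n) :
    Monotone (level p δ e) :=
  (monotone_offset δ e).const_add _

open scoped EuclideanSpace in
theorem mem_offsetLine_iff (he : p e ≠ p (e + 1)) :
    y ∈ offsetLine p δ e t ↔ ⟪inwardNormal p e, y⟫ = level p δ e t := by
  have hself : ⟪inwardNormal p e, inwardNormal p e⟫ = 1 := by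
    rw [real_inner_self_eq_norm_sq, norm_inwardNormal he, one_pow]
  constructor
  · rintro ⟨y₀, hy₀, rfl⟩
    obtain ⟨r, rfl⟩ := mem_affineSpan_pair_iff_exists_lineMap_eq.1 hy₀
    simp only [AffineMap.lineMap_apply, vsub_eq_sub, vadd_eq_add, level, inner_add_right,
      inner_smul_right, inner_inwardNormal_sub, hself]
    ring
  · intro hy
    obtain ⟨r, hr⟩ := exists_smul_eq_of_inner_eq_zero (inwardNormal_ne_zero he)
      (sub_ne_zero.2 he.symm) (u := y - p e - offset δ e t • inwardNormal p e)
      (by rw [inner_sub_right, inner_sub_right, inner_smul_right, hself, hy, level]; ring)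
      (inner_inwardNormal_sub p e)
    refine ⟨_, AffineMap.lineMap_mem_affineSpan_pair r (p e) (p (e + 1)), ?_⟩
    simp only [AffineMap.lineMap_apply, vsub_eq_sub, vadd_eq_add, hr]
    abel

end InwardNormal

section Arm

open scoped RealInnerProductSpace EuclideanSpace

theorem IsInwardArm.of_mem_segment {E : Type*} [NormedAddCommGroup E] [InnerProductSpace ℝ E]
    {C U : Set E} {a b c ν : E} (hC : segment ℝ a b ⊆ C) (hν : ν ≠ 0) (hab : ⟪ν, b⟫ = ⟪ν, a⟫)
    (hin : ∀ x ∈ openSegment ℝ a b, ∀ᶠ ε in 𝓝[>] (0 : ℝ), x + ε • ν ∈ filling C)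
    (hc : c ∈ segment ℝ a b) (hcU : c ∈ U) (hb : b ∉ U) : IsInwardArm C U c b ν where
  segment_subset := ((convex_segment a b).segment_subset hc (right_mem_segment ℝ a b)).trans hC
  notMem := hb
  inner_eq := by rw [inner_eq_of_mem_segment hab hc, hab]
  ne_zero := hν
  inward x hx :=
    hin x (openSegment_subset_openSegment_of_mem hc (fun h => hb (h ▸ hcU)) hx)

variable {n : ℕ} {v : ZMod n → Plane} {j : ZMod n} {c ν : Plane} {U : Set Plane}

theorem PointsInward.isInwardArm_right (h : PointsInward v j ν) (hν : ν ≠ 0)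
    (hj : ⟪ν, v (j + 1)⟫ = ⟪ν, v j⟫) (hc : c ∈ edge v j) (hcU : c ∈ U) (hU : v (j + 1) ∉ U) :
    IsInwardArm (curve v) U c (v (j + 1)) ν :=
  .of_mem_segment (edge_subset_curve v j) hν hj h hc hcU hU

theorem PointsInward.isInwardArm_left (h : PointsInward v j ν) (hν : ν ≠ 0)
    (hj : ⟪ν, v (j + 1)⟫ = ⟪ν, v j⟫) (hc : c ∈ edge v j) (hcU : c ∈ U) (hU : v j ∉ U) :
    IsInwardArm (curve v) U c (v j) ν :=
  .of_mem_segment (segment_symm ℝ (v j) _ ▸ edge_subset_curve v j) hν hj.symm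
    (openSegment_symm ℝ (v j) _ ▸ h) (segment_symm ℝ (v j) _ ▸ hc) hcU hU

variable {y : Plane}

theorem PointsInward.mem_region_of_vertex (hn : 3 ≤ n) {ν₁ ν₂ : Plane}
    (h₁ : PointsInward v j ν₁) (h₂ : PointsInward v (j + 1) ν₂) (hν₁ : ν₁ ≠ 0) (hν₂ : ν₂ ≠ 0)
    (hj₁ : ⟪ν₁, v (j + 1)⟫ = ⟪ν₁, v j⟫) (hj₂ : ⟪ν₂, v (j + 1 + 1)⟫ = ⟪ν₂, v (j + 1)⟫)
    (hUo : IsOpen U) (hUc : Convex ℝ U)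
    (hU : ∀ k ∉ ({j, j + 1} : Set (ZMod n)), Disjoint U (edge v k))
    (hj : v (j + 1) ∈ U) (hy : y ∈ U) (hy₁ : ⟪ν₁, v (j + 1)⟫ ≤ ⟪ν₁, y⟫)
    (hy₂ : ⟪ν₂, v (j + 1)⟫ ≤ ⟪ν₂, y⟫)
    (heq : ⟪ν₁, v (j + 1)⟫ = ⟪ν₁, y⟫ → ⟪ν₂, v (j + 1)⟫ = ⟪ν₂, y⟫ → y ∈ curve v) :
    y ∈ region v := by
  have hleft : v j ∉ U :=
    (hU (j - 1) (not_or.2 ⟨sub_one_ne_self hn j, sub_one_ne_add_one hn j⟩)).notMem_of_mem_right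
      (vertex_mem_edge_sub_one v j)
  have hright : v (j + 1 + 1) ∉ U :=
    (hU (j + 1 + 1) (not_or.2 ⟨add_one_add_one_ne_self hn j,
      add_one_ne_self hn _⟩)).notMem_of_mem_right (left_mem_segment ℝ _ _)
  refine IsInwardArm.mem_filling
    (h₁.isInwardArm_left hν₁ hj₁ (right_mem_segment ℝ _ _) hj hleft)
    (h₂.isInwardArm_right hν₂ hj₂ (left_mem_segment ℝ _ _) hj hright)
    ?_ hUo hUc hj hy hy₁ hy₂ heq
  intro q hq
  obtain ⟨k, rfl | rfl, hqk⟩ := exists_mem_edge_of_disjoint hU hq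
  · exact Or.inl (segment_symm ℝ (v k) _ ▸ hqk)
  · exact Or.inr hqk

theorem PointsInward.mem_region_of_mem_edge (hn : 3 ≤ n) (h : PointsInward v j ν) (hν : ν ≠ 0)
    (hj : ⟪ν, v (j + 1)⟫ = ⟪ν, v j⟫) (hUo : IsOpen U) (hUc : Convex ℝ U)
    (hU : ∀ k ∉ ({j} : Set (ZMod n)), Disjoint U (edge v k)) (hc : c ∈ edge v j) (hcU : c ∈ U)
    (hy : y ∈ U) (hcy : ⟪ν, c⟫ ≤ ⟪ν, y⟫) : y ∈ region v := by
  have hleft : v j ∉ U := (hU (j - 1) (sub_one_ne_self hn j)).notMem_of_mem_right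
    (vertex_mem_edge_sub_one v j)
  have hright : v (j + 1) ∉ U := (hU (j + 1) (add_one_ne_self hn j)).notMem_of_mem_right
    (left_mem_segment ℝ _ _)
  refine IsInwardArm.mem_filling (h.isInwardArm_left hν hj hc hcU hleft)
    (h.isInwardArm_right hν hj hc hcU hright) ?_ hUo hUc hcU hy hcy hcy fun heq _ =>
      edge_subset_curve v j (mem_segment_of_inner_eq hν hUc hcU hc hleft hright hj hy heq.symm)
  intro q hq
  obtain ⟨k, rfl, hqk⟩ := exists_mem_edge_of_disjoint hU hq
  exact segment_subset_union_of_mem hc hqk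

end Arm

namespace MovingPolygon.MovesBetween

open scoped RealInnerProductSpace EuclideanSpace

variable {n : ℕ} {p : ZMod n → Plane} {δ : ZMod n → ℝ} {K : MovingPolygon (ZMod n)}
  {a b s t τ : ℝ} {x : Plane} {j : ZMod K.size}

theorem inner_vertex (hp : ∀ e, p e ≠ p (e + 1)) (h : K.MovesBetween p δ a b) (ht : t ∈ Icc a b)
    (j : ZMod K.size) :
    ⟪inwardNormal p (K.label j), K.vertex t j⟫ = level p δ (K.label j) t :=
  (mem_offsetLine_iff (hp _)).1 (h.incident t ht j).1

theorem inner_vertex_add_one (hp : ∀ e, p e ≠ p (e + 1)) (h : K.MovesBetween p δ a b)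
    (ht : t ∈ Icc a b) (j : ZMod K.size) :
    ⟪inwardNormal p (K.label j), K.vertex t (j + 1)⟫ = level p δ (K.label j) t :=
  (mem_offsetLine_iff (hp _)).1 (h.incident t ht j).2

theorem inner_vertex_add_one_eq (hp : ∀ e, p e ≠ p (e + 1)) (h : K.MovesBetween p δ a b)
    (ht : t ∈ Icc a b) (j : ZMod K.size) :
    ⟪inwardNormal p (K.label j), K.vertex t (j + 1)⟫ =
      ⟪inwardNormal p (K.label j), K.vertex t j⟫ :=
  (h.inner_vertex_add_one hp ht j).trans (h.inner_vertex hp ht j).symm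

theorem inner_of_mem_edge (hp : ∀ e, p e ≠ p (e + 1)) (h : K.MovesBetween p δ a b)
    (ht : t ∈ Icc a b) (hx : x ∈ edge (K.vertex t) j) :
    ⟪inwardNormal p (K.label j), x⟫ = level p δ (K.label j) t :=
  (inner_eq_of_mem_segment (h.inner_vertex_add_one_eq hp ht j) hx).trans (h.inner_vertex hp ht j)

theorem exists_continuous_vertex (hp : ∀ e, p e ≠ p (e + 1)) (h : K.MovesBetween p δ a b)
    (j : ZMod K.size) : ∃ g : ℝ × ℝ → Plane, Continuous g ∧ ∀ t ∈ Icc a b,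
      K.vertex t (j + 1) = g (level p δ (K.label j) t, level p δ (K.label (j + 1)) t) := by
  by_cases hpar : inwardNormal p (K.label (j + 1)) = inwardNormal p (K.label j) ∨
      inwardNormal p (K.label (j + 1)) = -inwardNormal p (K.label j)
  · refine ⟨fun q => K.vertex a (j + 1) +
      (q.1 - level p δ (K.label j) a) • inwardNormal p (K.label j), by fun_prop, fun t ht => ?_⟩
    simp only [h.tangential j hpar t ht, level, add_sub_add_left_eq_sub]
  · rw [not_or] at hpar
    obtain ⟨g, hg, hginv⟩ := exists_continuous_inner_leftInverse (norm_inwardNormal (hp _))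
      (norm_inwardNormal (hp _)) hpar.1 hpar.2
    refine ⟨g, hg, fun t ht => ?_⟩
    rw [← h.inner_vertex_add_one hp ht, ← h.inner_vertex hp ht, hginv]

theorem vertex_eq_of_level_eq (hp : ∀ e, p e ≠ p (e + 1)) (h : K.MovesBetween p δ a b)
    (hs : s ∈ Icc a b) (ht : t ∈ Icc a b)
    (h₀ : level p δ (K.label j) s = level p δ (K.label j) t)
    (h₁ : level p δ (K.label (j + 1)) s = level p δ (K.label (j + 1)) t) :
    K.vertex s (j + 1) = K.vertex t (j + 1) := by
  obtain ⟨g, -, hg⟩ := h.exists_continuous_vertex hp j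
  rw [hg s hs, hg t ht, h₀, h₁]

theorem continuousOn_vertex (hp : ∀ e, p e ≠ p (e + 1)) (h : K.MovesBetween p δ a b)
    (j : ZMod K.size) : ContinuousOn (fun t => K.vertex t j) (Icc a b) := by
  obtain ⟨g, hg, hgv⟩ := h.exists_continuous_vertex hp (j - 1)
  simp only [sub_add_cancel] at hgv
  exact (hg.comp ((continuous_level p δ _).prodMk (continuous_level p δ _))).continuousOn.congr hgv

theorem tendsto_vertex (hp : ∀ e, p e ≠ p (e + 1)) (h : K.MovesBetween p δ a b)
    (hτ : τ ∈ Ioc a b) (j : ZMod K.size) :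
    Tendsto (fun t => K.vertex t j) (𝓝[<] τ) (𝓝 (K.vertex τ j)) := by
  rw [← nhdsWithin_Ioo_eq_nhdsLT hτ.1]
  exact (h.continuousOn_vertex hp j τ (Ioc_subset_Icc_self hτ)).mono_left
    (nhdsWithin_mono _ fun t ht => ⟨ht.1.le, ht.2.le.trans hτ.2⟩)

theorem eventually_vertex_mem_region (hp : ∀ e, p e ≠ p (e + 1)) (h : K.MovesBetween p δ a b)
    (hτ : τ ∈ Ioo a b) (j : ZMod K.size) :
    ∀ᶠ t in 𝓝[<] τ, K.vertex τ (j + 1) ∈ region (K.vertex t) := by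
  have hτab := Ioo_subset_Icc_self hτ
  have hsimple : IsSimplePolygon (K.vertex τ) := (h.planar τ (Or.inr ⟨hτ.1.le, hτ.2⟩)).1
  have := hsimple.neZero
  have htends := h.tendsto_vertex hp (Ioo_subset_Ioc_self hτ)
  obtain ⟨ρ, hρ, hball⟩ := exists_ball_disjoint_edge htends (S := {j, j + 1}) fun k hk =>
    hsimple.notMem_edge (right_mem_segment ℝ _ _) (not_or.1 hk).1 (hsimple.edge_ne j).symm
      (Or.inl (not_or.1 hk).2)
  filter_upwards [hball, (htends (j + 1)).eventually_mem (Metric.ball_mem_nhds _ hρ),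
    Ioo_mem_nhdsLT hτ.1] with t hfar hc ht
  have htab : t ∈ Icc a b := ⟨ht.1.le, (ht.2.trans hτ.2).le⟩
  obtain ⟨-, hinward⟩ := h.planar t (Or.inr ⟨htab.1, ht.2.trans hτ.2⟩)
  refine (hinward j).mem_region_of_vertex hsimple.three_le (hinward (j + 1))
    (inwardNormal_ne_zero (hp _)) (inwardNormal_ne_zero (hp _))
    (h.inner_vertex_add_one_eq hp htab j) (h.inner_vertex_add_one_eq hp htab (j + 1))
    Metric.isOpen_ball (convex_ball _ _) hfar hc (Metric.mem_ball_self hρ) ?_ ?_ ?_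
  · rw [h.inner_vertex_add_one hp htab, h.inner_vertex_add_one hp hτab]
    exact monotone_level p δ _ ht.2.le
  · rw [h.inner_vertex hp htab, h.inner_vertex hp hτab]
    exact monotone_level p δ _ ht.2.le
  · rw [h.inner_vertex_add_one hp htab, h.inner_vertex_add_one hp hτab, h.inner_vertex hp htab,
      h.inner_vertex hp hτab]
    intro h₁ h₂
    rw [← h.vertex_eq_of_level_eq hp htab hτab h₁ h₂]
    exact edge_subset_curve _ j (right_mem_segment ℝ _ _)

theorem eventually_mem_region_of_mem_edge (hp : ∀ e, p e ≠ p (e + 1)) (h : K.MovesBetween p δ a b)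
    (hτ : τ ∈ Ioo a b) (hx : x ∈ edge (K.vertex τ) j) (hx₀ : x ≠ K.vertex τ j)
    (hx₁ : x ≠ K.vertex τ (j + 1)) : ∀ᶠ t in 𝓝[<] τ, x ∈ region (K.vertex t) := by
  have hsimple : IsSimplePolygon (K.vertex τ) := (h.planar τ (Or.inr ⟨hτ.1.le, hτ.2⟩)).1
  have := hsimple.neZero
  have htends := h.tendsto_vertex hp (Ioo_subset_Ioc_self hτ)
  obtain ⟨ρ, hρ, hball⟩ := exists_ball_disjoint_edge htends (S := {j})
    fun k hk => hsimple.notMem_edge hx hk hx₀ (Or.inr hx₁)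
  obtain ⟨c, hcx, hcedge⟩ := exists_tendsto_mem_edge htends hx
  filter_upwards [hball, hcx.eventually_mem (Metric.ball_mem_nhds _ hρ),
    Ioo_mem_nhdsLT hτ.1] with t hfar hc ht
  have htab : t ∈ Icc a b := ⟨ht.1.le, (ht.2.trans hτ.2).le⟩
  obtain ⟨-, hinward⟩ := h.planar t (Or.inr ⟨htab.1, ht.2.trans hτ.2⟩)
  refine (hinward j).mem_region_of_mem_edge hsimple.three_le (inwardNormal_ne_zero (hp _))
    (h.inner_vertex_add_one_eq hp htab j) Metric.isOpen_ball (convex_ball _ _) hfar (hcedge t) hc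
    (Metric.mem_ball_self hρ) ?_
  rw [h.inner_of_mem_edge hp htab (hcedge t), h.inner_of_mem_edge hp (Ioo_subset_Icc_self hτ) hx]
  exact monotone_level p δ _ ht.2.le

theorem eventually_mem_region_of_mem_curve (hp : ∀ e, p e ≠ p (e + 1)) (h : K.MovesBetween p δ a b)
    (hτ : τ ∈ Ioo a b) (hx : x ∈ curve (K.vertex τ)) :
    ∀ᶠ t in 𝓝[<] τ, x ∈ region (K.vertex t) := by
  obtain ⟨j, hxj⟩ := mem_iUnion.1 hx
  by_cases hx₁ : x = K.vertex τ (j + 1)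
  · exact hx₁ ▸ h.eventually_vertex_mem_region hp hτ j
  by_cases hx₀ : x = K.vertex τ j
  · have hvertex := h.eventually_vertex_mem_region hp hτ (j - 1)
    rwa [sub_add_cancel, ← hx₀] at hvertex
  · exact h.eventually_mem_region_of_mem_edge hp hτ hxj hx₀ hx₁

theorem neZero_size (h : K.MovesBetween p δ a b) : NeZero K.size :=
  (h.planar a (Or.inl rfl)).1.neZero

theorem region_subset_region (hp : ∀ e, p e ≠ p (e + 1)) (h : K.MovesBetween p δ a b)
    (has : a ≤ s) (hst : s ≤ t) (htb : t < b) : region (K.vertex t) ⊆ region (K.vertex s) := by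
  have := h.neZero_size
  have hsub : Icc s t ⊆ Icc a b := Icc_subset_Icc has htb.le
  exact filling_subset_filling_of_frequently hst
    (isCompact_setOf_mem_curve isCompact_Icc fun j => (h.continuousOn_vertex hp j).mono hsub)
    fun τ hτ y hy => (h.eventually_mem_region_of_mem_curve hp
      ⟨has.trans_lt hτ.1, hτ.2.trans_lt htb⟩ hy).frequently

theorem curve_subset_region (hp : ∀ e, p e ≠ p (e + 1)) (h : K.MovesBetween p δ a b)
    (hs : s ∈ Icc a b) : curve (K.vertex b) ⊆ region (K.vertex s) := by
  have := h.neZero_size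
  rcases hs.2.eq_or_lt with rfl | hsb
  · exact StraightSkeleton.curve_subset_region _
  have htends := h.tendsto_vertex hp ⟨hs.1.trans_lt hsb, le_rfl⟩
  refine iUnion_subset fun j x hx => ?_
  obtain ⟨c, hcx, hcedge⟩ := exists_tendsto_mem_edge htends hx
  refine (isClosed_region _).mem_of_tendsto hcx ?_
  filter_upwards [Ioo_mem_nhdsLT hsb] with t ht
  exact h.region_subset_region hp hs.1 ht.1.le ht.2 <|
    StraightSkeleton.curve_subset_region _ (edge_subset_curve _ j (hcedge t))

end MovingPolygon.MovesBetween

section Event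

theorem segment_subset_closure_sdiff_finite {E : Type*} [AddCommGroup E] [Module ℝ E]
    [TopologicalSpace E] [IsTopologicalAddGroup E] [ContinuousSMul ℝ E] {a b : E} (hab : a ≠ b)
    {F : Set E} (hF : F.Finite) : segment ℝ a b ⊆ closure (segment ℝ a b \ F) := by
  let f : ℝ →ᵃ[ℝ] E := AffineMap.lineMap a b
  have hfF : (f ⁻¹' F).Finite := hF.preimage (AffineMap.lineMap_injective ℝ hab).injOn
  have hIoo : Ioo (0 : ℝ) 1 ⊆ closure (Ioo 0 1 \ f ⁻¹' F) := by
    rw [sdiff_eq, compl_eq_univ_sdiff]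
    exact (dense_univ.sdiff_finite hfF).open_subset_closure_inter isOpen_Ioo
  rw [segment_eq_image_lineMap]
  calc f '' Icc 0 1 ⊆ f '' closure (Ioo 0 1 \ f ⁻¹' F) := image_mono <| by
        rw [← closure_Ioo zero_ne_one]
        exact closure_minimal hIoo isClosed_closure
    _ ⊆ closure (f '' (Ioo 0 1 \ f ⁻¹' F)) :=
        image_closure_subset_closure_image AffineMap.lineMap_continuous
    _ ⊆ closure (f '' Icc 0 1 \ F) := closure_mono <| by
        rw [image_sdiff_preimage]
        exact sdiff_subset_sdiff_left (image_mono Ioo_subset_Icc_self)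

variable {n : ℕ} {p : ZMod n → Plane} {δ : ZMod n → ℝ} {t : ℝ} {K K' : MovingPolygon (ZMod n)}
  {L : List (MovingPolygon (ZMod n))}

theorem edge_subset_fragments (K : MovingPolygon (ZMod n)) (j : ZMod K.size) (t : ℝ) :
    edge (K.vertex t) j ⊆ fragments K (K.label j) t :=
  subset_iUnion₂_of_subset j rfl le_rfl

theorem fragments_subset_curve (K : MovingPolygon (ZMod n)) (e : ZMod n) (t : ℝ) :
    fragments K e t ⊆ curve (K.vertex t) :=
  iUnion₂_subset fun j _ => edge_subset_curve _ j

theorem Resolves.curve_subset_curve [NeZero K.size] (h : Resolves p δ t K L) (hK' : K' ∈ L)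
    (hne : ∀ j, K'.vertex t j ≠ K'.vertex t (j + 1)) :
    curve (K'.vertex t) ⊆ curve (K.vertex t) := by
  refine iUnion_subset fun j => (segment_subset_closure_sdiff_finite (hne j)
    (h.boundary (K'.label j))).trans (closure_minimal ?_ (isClosed_curve _))
  rintro x ⟨hx, hxF⟩
  by_contra hxK
  refine hxF (Or.inl ⟨?_, fun hold => hxK ?_⟩)
  · exact mem_biUnion hK' (mem_biUnion (mem_ofPred.2 rfl) (edge_subset_fragments K' j t hx))
  · obtain ⟨e, -, he⟩ := mem_iUnion₂.1 hold.1
    exact fragments_subset_curve K e t he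

end Event

namespace Propagation

variable {n : ℕ} {p : ZMod n → Plane} {δ : ZMod n → ℝ} {i k : ℕ} {s t : ℝ}
  {K K' : MovingPolygon (ZMod n)}

theorem exists_region_subset_region (W : Propagation p δ) (hp : ∀ e, p e ≠ p (e + 1))
    (hi : i + 1 < W.N) (hK' : K' ∈ W.polygons (i + 1)) :
    ∃ K ∈ W.polygons i, ∀ s ∈ Icc (W.time i) (W.time (i + 1)),
      region (K'.vertex (W.time (i + 1))) ⊆ region (K.vertex s) := by
  have hiN : i < W.N := i.lt_succ_self.trans hi
  have hsimple := ((W.moves (i + 1) hi K' hK').planar _ (Or.inl rfl)).1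
  obtain ⟨successors, hresolves, hsucc⟩ := W.event i hiN
  rw [hsucc, List.mem_flatMap] at hK'
  obtain ⟨K, hK, hK'⟩ := hK'
  have hmoves := W.moves i hiN K hK
  have := hmoves.neZero_size
  exact ⟨K, hK, fun s hs => filling_subset_filling
    (((hresolves K hK).curve_subset_curve hK' hsimple.edge_ne).trans
      (hmoves.curve_subset_region hp hs))⟩

theorem region_subset_wavefront (W : Propagation p δ) (hp : ∀ e, p e ≠ p (e + 1)) (hk : k < W.N)
    (hK : K ∈ W.polygons k) (hs : 0 ≤ s) (hsk : s < W.time k) :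
    region (K.vertex (W.time k)) ⊆ W.wavefront s := by
  induction k generalizing K with
  | zero => exact absurd (W.time_zero ▸ hsk) hs.not_gt
  | succ i ih =>
    have hi : i < W.N := i.lt_succ_self.trans hk
    obtain ⟨K₀, hK₀, hsub⟩ := W.exists_region_subset_region hp hk hK
    rcases le_or_gt (W.time i) s with his | hsi
    · exact fun x hx => ⟨i, hi, his, hsk, K₀, hK₀, hsub s ⟨his, hsk.le⟩ hx⟩
    · exact (hsub _ (left_mem_Icc.2 (W.time_le i hi))).trans (ih hi hK₀ hsi)

theorem wavefront_subset_wavefront (W : Propagation p δ) (hp : ∀ e, p e ≠ p (e + 1)) (hs : 0 ≤ s)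
    (hst : s ≤ t) : W.wavefront t ⊆ W.wavefront s := by
  rintro x ⟨k, hk, hkt, htk, K, hK, hx⟩
  have hmoves := W.moves k hk K hK
  rcases le_or_gt (W.time k) s with hks | hsk
  · exact ⟨k, hk, hks, hst.trans_lt htk, K, hK, hmoves.region_subset_region hp hks hst htk hx⟩
  · exact W.region_subset_wavefront hp hk hK hs hsk
      (hmoves.region_subset_region hp le_rfl hkt htk hx)

end Propagation

section Tangential

open scoped RealInnerProductSpace EuclideanSpace

variable {n : ℕ}

/-- The convex polygon with vertices `v i` is circumscribed about the circle of radius `ρ` around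
the origin; `ν i` is the unit normal pointing inwards at the edge from `v i` to `v (i + 1)`. -/
structure IsTangential (v ν : ZMod n → Plane) (ρ : ℝ) : Prop where
  three_le : 3 ≤ n
  pos : 0 < ρ
  norm_eq : ∀ i, ‖ν i‖ = 1
  inner_left : ∀ i, ⟪ν i, v i⟫ = -ρ
  inner_right : ∀ i, ⟪ν i, v (i + 1)⟫ = -ρ
  lt_inner : ∀ i k, k ≠ i → k ≠ i + 1 → -ρ < ⟪ν i, v k⟫
  isBounded : Bornology.IsBounded {x | ∀ i, -ρ ≤ ⟪ν i, x⟫}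

namespace IsTangential

variable {v ν : ZMod n → Plane} {ρ : ℝ} {i k : ZMod n} {x : Plane}

theorem smul (h : IsTangential v ν ρ) {c : ℝ} (hc : 0 < c) :
    IsTangential (fun i => c • v i) ν (c * ρ) where
  three_le := h.three_le
  pos := mul_pos hc h.pos
  norm_eq := h.norm_eq
  inner_left i := by rw [inner_smul_right, h.inner_left, mul_neg]
  inner_right i := by rw [inner_smul_right, h.inner_right, mul_neg]
  lt_inner i k hki hki' := by
    rw [inner_smul_right, ← mul_neg]
    exact mul_lt_mul_of_pos_left (h.lt_inner i k hki hki') hc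
  isBounded := (h.isBounded.smul₀ c).subset fun x hx => by
    refine ⟨c⁻¹ • x, fun i => ?_, smul_inv_smul₀ hc.ne' x⟩
    rw [inner_smul_right, ← div_eq_inv_mul, le_div_iff₀' hc, mul_neg]
    exact hx i

theorem ne_zero (h : IsTangential v ν ρ) (i : ZMod n) : ν i ≠ 0 :=
  norm_ne_zero_iff.1 (by rw [h.norm_eq]; exact one_ne_zero)

theorem neg_le_inner (h : IsTangential v ν ρ) (i k : ZMod n) : -ρ ≤ ⟪ν i, v k⟫ := by
  by_cases hki : k = i
  · rw [hki, h.inner_left]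
  by_cases hki' : k = i + 1
  · rw [hki', h.inner_right]
  · exact (h.lt_inner i k hki hki').le

theorem neg_le_inner_of_mem_curve (h : IsTangential v ν ρ) (hx : x ∈ curve v) (i : ZMod n) :
    -ρ ≤ ⟪ν i, x⟫ := by
  obtain ⟨k, hk⟩ := mem_iUnion.1 hx
  exact (convex_halfSpace_ge (innerₗ Plane (ν i)).isLinear (-ρ)).segment_subset
    (h.neg_le_inner i k) (h.neg_le_inner i (k + 1)) hk

theorem inner_of_mem_edge (h : IsTangential v ν ρ) (hx : x ∈ edge v i) : ⟪ν i, x⟫ = -ρ := by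
  rw [inner_eq_of_mem_segment (by rw [h.inner_left, h.inner_right]) hx, h.inner_left]

theorem ne_add_one (h : IsTangential v ν ρ) (i : ZMod n) : v i ≠ v (i + 1) := fun hi => by
  have hlt := h.lt_inner (i + 1) i (add_one_ne_self h.three_le i).symm
    (add_one_add_one_ne_self h.three_le i).symm
  rw [hi, h.inner_left] at hlt
  exact lt_irrefl _ hlt

theorem eq_vertex_of_mem_edge (h : IsTangential v ν ρ) (hki : k ≠ i) (hx : x ∈ edge v i)
    (hxk : ⟪ν k, x⟫ = -ρ) : x = v i ∧ i = k + 1 ∨ x = v (i + 1) ∧ k = i + 1 := by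
  have hn := h.three_le
  by_cases hik : i = k + 1
  · refine Or.inl ⟨eq_right_of_mem_segment ((segment_symm ℝ _ _).subset hx) (h.lt_inner k _ ?_ ?_)
      (h.neg_le_inner k i) hxk, hik⟩
    · exact hik ▸ add_one_add_one_ne_self hn k
    · exact hik ▸ add_one_ne_self hn i
  have hxv : x = v (i + 1) := eq_right_of_mem_segment hx (h.lt_inner k i hki.symm hik)
    (h.neg_le_inner k _) hxk
  refine Or.inr ⟨hxv, by_contra fun hki' => ?_⟩
  exact (h.lt_inner k (i + 1) (Ne.symm hki') fun h => hki (add_right_cancel h).symm).ne'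
    (hxv ▸ hxk)

theorem lt_inner_of_mem_openSegment (h : IsTangential v ν ρ) (hki : k ≠ i)
    (hx : x ∈ openSegment ℝ (v i) (v (i + 1))) : -ρ < ⟪ν k, x⟫ := by
  have hxe : x ∈ edge v i := openSegment_subset_segment ℝ _ _ hx
  refine (h.neg_le_inner_of_mem_curve (edge_subset_curve v i hxe) k).lt_of_ne' fun hxk => ?_
  rcases h.eq_vertex_of_mem_edge hki hxe hxk with ⟨rfl, -⟩ | ⟨rfl, -⟩
  · exact h.ne_add_one i (left_mem_openSegment_iff.1 hx)
  · exact h.ne_add_one i (right_mem_openSegment_iff.1 hx)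

theorem isSimplePolygon (h : IsTangential v ν ρ) : IsSimplePolygon v where
  three_le := h.three_le
  edge_ne := h.ne_add_one
  consecutive i := by
    refine Subset.antisymm ?_ (singleton_subset_iff.2
      ⟨right_mem_segment ℝ _ _, left_mem_segment ℝ _ _⟩)
    rintro x ⟨hx, hx'⟩
    rcases h.eq_vertex_of_mem_edge (add_one_ne_self h.three_le i) hx (h.inner_of_mem_edge hx')
      with ⟨-, hi⟩ | ⟨hxv, -⟩
    · exact absurd hi.symm (add_one_add_one_ne_self h.three_le i)
    · exact hxv
  nonconsecutive i j hji hji' hij := disjoint_left.2 fun x hxi hxj => by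
    rcases h.eq_vertex_of_mem_edge hji hxi (h.inner_of_mem_edge hxj) with ⟨-, hi⟩ | ⟨-, hj⟩
    · exact hij hi
    · exact hji' hj

theorem mem_edge (h : IsTangential v ν ρ) (hx : ∀ k, -ρ ≤ ⟪ν k, x⟫) (hxi : ⟪ν i, x⟫ = -ρ) :
    x ∈ edge v i := by
  have hn := h.three_le
  obtain ⟨r, hr⟩ := exists_smul_eq_of_inner_eq_zero (h.ne_zero i)
    (sub_ne_zero.2 (h.ne_add_one i).symm) (u := x - v i)
    (by rw [inner_sub_right, hxi, h.inner_left, sub_self])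
    (by rw [inner_sub_right, h.inner_right, h.inner_left, sub_self])
  obtain rfl : v i + r • (v (i + 1) - v i) = x := by rw [hr, add_sub_cancel]
  have hinner (k : ZMod n) : -ρ ≤ ⟪ν k, v i⟫ + r * (⟪ν k, v (i + 1)⟫ - ⟪ν k, v i⟫) := by
    simpa only [inner_add_right, inner_smul_right, inner_sub_right] using hx k
  have hr₀ : 0 ≤ r := by
    have hprev := hinner (i - 1)
    have hright := h.inner_right (i - 1)
    rw [sub_add_cancel] at hright
    have hlt := h.lt_inner (i - 1) (i + 1) (sub_one_ne_add_one hn i).symm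
      (by rw [sub_add_cancel]; exact add_one_ne_self hn i)
    rw [hright] at hprev
    nlinarith
  have hr₁ : r ≤ 1 := by
    have hnext := hinner (i + 1)
    have hlt := h.lt_inner (i + 1) i (add_one_ne_self hn i).symm
      (add_one_add_one_ne_self hn i).symm
    rw [h.inner_left (i + 1)] at hnext
    nlinarith
  exact (segment_eq_image' ℝ _ _).superset ⟨r, ⟨hr₀, hr₁⟩, rfl⟩

theorem subset_region (h : IsTangential v ν ρ) : {x | ∀ i, -ρ ≤ ⟪ν i, x⟫} ⊆ region v := by
  have := h.isSimplePolygon.neZero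
  refine subset_filling_of_frontier_subset h.isBounded fun x hx => ?_
  have hclosed : IsClosed {x | ∀ i, -ρ ≤ ⟪ν i, x⟫} := by
    simp only [ofPred_forall]
    exact isClosed_iInter fun i => isClosed_le continuous_const (by fun_prop)
  have hxP : ∀ i, -ρ ≤ ⟪ν i, x⟫ := hclosed.frontier_subset hx
  by_contra hxc
  refine hx.2 (mem_interior_iff_mem_nhds.2 ?_)
  have hlt : ∀ i, ∀ᶠ y in 𝓝 x, -ρ < ⟪ν i, y⟫ := fun i =>
    continuousAt_const.eventually_lt (Continuous.continuousAt (by fun_prop)) <|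
      (hxP i).lt_of_ne' fun hxi => hxc (edge_subset_curve v i (h.mem_edge hxP hxi))
  filter_upwards [eventually_all.2 hlt] with y hy i using (hy i).le

theorem pointsInward (h : IsTangential v ν ρ) (i : ZMod n) : PointsInward v i (ν i) := by
  intro x hx
  have := h.isSimplePolygon.neZero
  have hle (k : ZMod n) : ∀ᶠ ε in 𝓝[>] (0 : ℝ), -ρ ≤ ⟪ν k, x + ε • ν i⟫ := by
    by_cases hki : k = i
    · filter_upwards [self_mem_nhdsWithin] with ε (hε : 0 < ε)
      rw [hki, inner_add_right, h.inner_of_mem_edge (openSegment_subset_segment ℝ _ _ hx),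
        inner_smul_right, real_inner_self_eq_norm_sq, h.norm_eq]
      linarith
    · have hcont : Continuous fun ε : ℝ => ⟪ν k, x + ε • ν i⟫ := by fun_prop
      refine ((hcont.tendsto' 0 ⟪ν k, x⟫ (by rw [zero_smul, add_zero])).mono_left
        nhdsWithin_le_nhds).eventually ?_
      exact (lt_mem_nhds (h.lt_inner_of_mem_openSegment hki hx)).mono fun _ => le_of_lt
  filter_upwards [eventually_all.2 hle] with ε hε using h.subset_region hε

theorem not_pointsInward_neg (h : IsTangential v ν ρ) (i : ZMod n) :
    ¬ PointsInward v i (-ν i) := by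
  intro hin
  obtain ⟨x, hx⟩ : (openSegment ℝ (v i) (v (i + 1))).Nonempty :=
    openSegment_eq_image_lineMap ℝ (v i) (v (i + 1)) ▸ (nonempty_Ioo.2 zero_lt_one).image _
  obtain ⟨ε, hε, hpos : 0 < ε⟩ := ((hin x hx).and self_mem_nhdsWithin).exists
  have hle := le_inner_of_mem_filling (h.ne_zero i)
    (fun y hy => h.neg_le_inner_of_mem_curve hy i) hε
  rw [inner_add_right, h.inner_of_mem_edge (openSegment_subset_segment ℝ _ _ hx), inner_smul_right,
    inner_neg_right, real_inner_self_eq_norm_sq, h.norm_eq] at hle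
  linarith

theorem inwardNormal_eq (h : IsTangential v ν ρ) (i : ZMod n) : inwardNormal v i = ν i := by
  have hperp : ⟪v (i + 1) - v i, ν i⟫ = 0 := by
    rw [real_inner_comm, inner_sub_right, h.inner_left, h.inner_right, sub_self]
  rcases eq_or_eq_neg_of_norm_eq_one (sub_ne_zero.2 (h.ne_add_one i).symm) (h.norm_eq i)
    (norm_leftNormal (h.ne_add_one i)) hperp
    ((real_inner_comm _ _).trans (inner_leftNormal_sub _ _)) with hleft | hleft
  · rw [inwardNormal, hleft, if_pos (h.pointsInward i)]
  · rw [inwardNormal, hleft, if_neg (h.not_pointsInward_neg i), neg_neg]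

theorem normal_ne (h : IsTangential v ν ρ) (i : ZMod n) : ν (i + 1) ≠ ν i := fun hν => by
  have hlt := h.lt_inner (i + 1) i (add_one_ne_self h.three_le i).symm
    (add_one_add_one_ne_self h.three_le i).symm
  rw [hν, h.inner_left] at hlt
  exact lt_irrefl _ hlt

theorem normal_ne_neg (h : IsTangential v ν ρ) (i : ZMod n) : ν (i + 1) ≠ -ν i := fun hν => by
  have hleft := h.inner_left (i + 1)
  rw [hν, inner_neg_left, h.inner_right] at hleft
  linarith [h.pos]

end IsTangential

/-- The wavefront polygon that waits until time `d` and then shrinks towards the origin, keeping its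
shape, at such a rate that an inscribed circle of radius `ρ` around the origin loses radius at unit
speed. -/
def shrinkingPolygon (v : ZMod n → Plane) (ρ d : ℝ) : MovingPolygon (ZMod n) :=
  ⟨n, id, fun t i => (1 - max 0 (t - d) / ρ) • v i⟩

theorem shrinkingPolygon_vertex_of_le {v : ZMod n → Plane} {ρ d t : ℝ} (ht : t ≤ d) :
    (shrinkingPolygon v ρ d).vertex t = v := by
  funext i
  change (1 - max 0 (t - d) / ρ) • v i = v i
  rw [max_eq_left (sub_nonpos.2 ht), zero_div, sub_zero, one_smul]

namespace IsTangential

variable {v ν : ZMod n → Plane} {ρ d t : ℝ} {i : ZMod n} {x : Plane}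

theorem smul_mem_offsetLine (h : IsTangential v ν ρ) (hx : ⟪ν i, x⟫ = -ρ) :
    (1 - max 0 (t - d) / ρ) • x ∈ offsetLine v (fun _ => d) i t := by
  rw [mem_offsetLine_iff (h.ne_add_one i), level, offset, h.inwardNormal_eq, inner_smul_right, hx,
    h.inner_left]
  have := h.pos
  field_simp
  ring

theorem shrinkingPolygon_movesBetween (h : IsTangential v ν ρ) (hd : 0 ≤ d) :
    (shrinkingPolygon v ρ d).MovesBetween v (fun _ => d) 0 (d + ρ) where
  planar t ht := by
    have hscale : 0 < 1 - max 0 (t - d) / ρ := by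
      rw [sub_pos, div_lt_one h.pos, max_lt_iff, sub_lt_iff_lt_add']
      refine ⟨h.pos, ?_⟩
      rcases ht with rfl | ht
      · exact add_pos_of_nonneg_of_pos hd h.pos
      · exact ht.2
    refine ⟨(h.smul hscale).isSimplePolygon, fun j => ?_⟩
    rw [h.inwardNormal_eq]
    exact (h.smul hscale).pointsInward j
  incident t _ j :=
    ⟨h.smul_mem_offsetLine (h.inner_left j), h.smul_mem_offsetLine (h.inner_right j)⟩
  tangential j hj := by
    rw [h.inwardNormal_eq, h.inwardNormal_eq] at hj
    exact absurd hj (not_or.2 ⟨h.normal_ne j, h.normal_ne_neg j⟩)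

theorem resolves_shrinkingPolygon (h : IsTangential v ν ρ) :
    Resolves v (fun _ => d) (d + ρ) (shrinkingPolygon v ρ d) [] where
  boundary e := by
    have hvertex (j : ZMod (shrinkingPolygon v ρ d).size) :
        (shrinkingPolygon v ρ d).vertex (d + ρ) j = 0 := by
      change (1 - max 0 (d + ρ - d) / ρ) • v j = 0
      rw [add_sub_cancel_left, max_eq_right h.pos.le, div_self h.pos.ne', sub_self, zero_smul]
    refine (finite_singleton (0 : Plane)).subset ?_
    rintro x (⟨hx, -⟩ | ⟨⟨hx, -⟩, -⟩)
    · simp at hx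
    · simp only [fragments, mem_iUnion, edge, hvertex, segment_same] at hx
      obtain ⟨-, -, -, -, hx⟩ := hx
      exact hx
  label_old := by simp
  label_other := by simp

/-- The process in which the polygon waits until time `d` and vanishes at time `d + ρ`. -/
def propagation (h : IsTangential v ν ρ) (hd : 0 ≤ d) : Propagation v (fun _ => d) where
  N := 1
  time i := (d + ρ) * i
  polygons i := if i = 0 then [shrinkingPolygon v ρ d] else []
  time_zero := by rw [Nat.cast_zero, mul_zero]
  time_le i _ := by
    have := h.pos
    gcongr
    exact i.le_succ
  initial := ⟨_, rfl, shrinkingPolygon_vertex_of_le hd⟩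
  moves i hi K hK := by
    obtain rfl : i = 0 := Nat.lt_one_iff.1 hi
    obtain rfl : K = shrinkingPolygon v ρ d := List.mem_singleton.1 hK
    simpa using h.shrinkingPolygon_movesBetween hd
  event i hi := by
    obtain rfl : i = 0 := Nat.lt_one_iff.1 hi
    refine ⟨fun _ => [], fun K hK => ?_, rfl⟩
    obtain rfl : K = shrinkingPolygon v ρ d := List.mem_singleton.1 hK
    simpa using h.resolves_shrinkingPolygon
  final := rfl

theorem wavefront_propagation (h : IsTangential v ν ρ) (hd : 0 ≤ d) (h₀ : 0 ≤ t) (htd : t ≤ d) :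
    (h.propagation hd).wavefront t = region v := by
  ext x
  constructor
  · rintro ⟨i, hi, -, -, K, hK, hx⟩
    obtain rfl : i = 0 := Nat.lt_one_iff.1 hi
    obtain rfl : K = shrinkingPolygon v ρ d := List.mem_singleton.1 hK
    rwa [shrinkingPolygon_vertex_of_le htd] at hx
  · intro hx
    refine ⟨0, Nat.one_pos, ?_, ?_, shrinkingPolygon v ρ d, List.mem_singleton.2 rfl, ?_⟩
    · simpa [propagation] using h₀
    · simpa [propagation] using htd.trans_lt (lt_add_of_pos_right d h.pos)
    · rwa [shrinkingPolygon_vertex_of_le htd]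

end IsTangential

theorem zmod_three_two_add_one : (2 : ZMod 3) + 1 = 0 := by decide

theorem forall_zmod_three {P : ZMod 3 → Prop} : (∀ i, P i) ↔ P 0 ∧ P 1 ∧ P 2 :=
  Fin.forall_fin_succ.trans (and_congr_right fun _ => Fin.forall_fin_two)

/-- The right triangle with inradius `1`, incenter at the origin and edge lengths `4`, `5`, `3`. -/
def rightTriangle : ZMod 3 → Plane :=
  (![!₂[-1, -1], !₂[3, -1], !₂[-1, 2]] : Fin 3 → Plane)

/-- The inward unit normals of `rightTriangle`. -/
def rightTriangleNormal : ZMod 3 → Plane :=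
  (![!₂[0, 1], !₂[-(3 / 5), -(4 / 5)], !₂[1, 0]] : Fin 3 → Plane)

theorem rightTriangle_zero : rightTriangle 0 = !₂[-1, -1] := rfl

theorem rightTriangle_one : rightTriangle 1 = !₂[3, -1] := rfl

theorem rightTriangle_two : rightTriangle 2 = !₂[-1, 2] := rfl

theorem rightTriangleNormal_zero : rightTriangleNormal 0 = !₂[0, 1] := rfl

theorem rightTriangleNormal_one : rightTriangleNormal 1 = !₂[-(3 / 5), -(4 / 5)] := rfl

theorem rightTriangleNormal_two : rightTriangleNormal 2 = !₂[1, 0] := rfl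

theorem inner_rightTriangleNormal_zero (x : Plane) : ⟪rightTriangleNormal 0, x⟫ = x 1 := by
  simp [rightTriangleNormal_zero, PiLp.inner_apply, Fin.sum_univ_two]

theorem inner_rightTriangleNormal_one (x : Plane) :
    ⟪rightTriangleNormal 1, x⟫ = -(3 * x 0 + 4 * x 1) / 5 := by
  rw [rightTriangleNormal_one, PiLp.inner_apply, Fin.sum_univ_two]
  simp only [Matrix.cons_val_zero, Matrix.cons_val_one, RCLike.inner_apply, conj_trivial]
  ring

theorem inner_rightTriangleNormal_two (x : Plane) : ⟪rightTriangleNormal 2, x⟫ = x 0 := by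
  simp [rightTriangleNormal_two, PiLp.inner_apply, Fin.sum_univ_two]

theorem isTangential_rightTriangle : IsTangential rightTriangle rightTriangleNormal 1 where
  three_le := le_rfl
  pos := one_pos
  norm_eq := by
    have hsq : ∀ i, ⟪rightTriangleNormal i, rightTriangleNormal i⟫ = 1 := by
      simp only [forall_zmod_three, inner_rightTriangleNormal_zero, inner_rightTriangleNormal_one,
        inner_rightTriangleNormal_two]
      norm_num [rightTriangleNormal_zero, rightTriangleNormal_one, rightTriangleNormal_two]
    exact fun i => by rw [norm_eq_sqrt_real_inner, hsq, Real.sqrt_one]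
  inner_left := by
    simp only [forall_zmod_three, inner_rightTriangleNormal_zero, inner_rightTriangleNormal_one,
      inner_rightTriangleNormal_two]
    norm_num [rightTriangle_zero, rightTriangle_one, rightTriangle_two]
  inner_right := by
    simp only [forall_zmod_three, zero_add, one_add_one_eq_two, zmod_three_two_add_one,
      inner_rightTriangleNormal_zero, inner_rightTriangleNormal_one, inner_rightTriangleNormal_two]
    norm_num [rightTriangle_zero, rightTriangle_one, rightTriangle_two]
  lt_inner i k hki hki' := by
    obtain rfl : i = k + 1 := by decide +revert
    clear hki hki'
    revert k
    simp only [forall_zmod_three, zero_add, one_add_one_eq_two, zmod_three_two_add_one,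
      inner_rightTriangleNormal_zero, inner_rightTriangleNormal_one, inner_rightTriangleNormal_two]
    norm_num [rightTriangle_zero, rightTriangle_one, rightTriangle_two]
  isBounded := by
    simp only [forall_zmod_three, inner_rightTriangleNormal_zero, inner_rightTriangleNormal_one,
      inner_rightTriangleNormal_two]
    refine isBounded_iff_forall_norm_le.2 ⟨5, fun x ⟨h₁, h, h₀⟩ => ?_⟩
    rw [EuclideanSpace.norm_eq, Fin.sum_univ_two, Real.sqrt_le_left (by norm_num),
      Real.norm_eq_abs, Real.norm_eq_abs, sq_abs, sq_abs]
    nlinarith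

end Tangential

end StraightSkeleton

end

theorem mainTheorem1 :
    (∀ (n : ℕ) (p : ZMod n → StraightSkeleton.Plane), StraightSkeleton.IsSimplePolygon p →
      ∀ δ : ZMod n → ℝ, (∀ e, 0 ≤ δ e) →
      ∀ (W : StraightSkeleton.Propagation p δ) (t₁ t₂ : ℝ), 0 ≤ t₁ → t₁ < t₂ →
        W.wavefront t₂ ⊆ W.wavefront t₁) ∧
    (∃ (n : ℕ) (p : ZMod n → StraightSkeleton.Plane) (δ : ZMod n → ℝ)
      (W : StraightSkeleton.Propagation p δ) (t₁ t₂ : ℝ),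
        StraightSkeleton.IsSimplePolygon p ∧ (∀ e, 0 ≤ δ e) ∧ 0 ≤ t₁ ∧ t₁ < t₂ ∧
        (W.wavefront t₁).Nonempty ∧ W.wavefront t₂ = W.wavefront t₁) := by
  refine ⟨fun n p hp δ _ W t₁ t₂ h₁ h₁₂ => W.wavefront_subset_wavefront hp.edge_ne h₁ h₁₂.le, ?_⟩
  have htriangle := StraightSkeleton.isTangential_rightTriangle
  have hwaits {t : ℝ} := htriangle.wavefront_propagation (t := t) zero_le_one
  refine ⟨3, StraightSkeleton.rightTriangle, fun _ => 1, htriangle.propagation zero_le_one, 0, 1,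
    htriangle.isSimplePolygon, fun _ => zero_le_one, le_rfl, one_pos, ?_, ?_⟩
  · rw [hwaits le_rfl zero_le_one]
    exact ⟨_, StraightSkeleton.curve_subset_region _
      (StraightSkeleton.edge_subset_curve _ 0 (left_mem_segment ℝ _ _))⟩
  · rw [hwaits le_rfl zero_le_one, hwaits zero_le_one le_rfl]
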